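/- Let $M$ be a smooth (Hausdorff, finite-dimensional) manifold, let $K:TM\to TM$ be an invertible smooth vector bundle endomorphism over the identity of $M$, and let $L\in\Omega^2(M;TM)$ be a vector-valued $2$-form. Let $\imath_K,\imath_L$ denote the insertion derivations of $\Omega(M)$, of degrees $0$ and $1$: for a $p$-form $\omega$, $p\ge 1$, and vector fields $X_i$, $$\imath_K\omega(X_1,\dots,X_p)=\sum_{i}\omega(X_1,\dots,KX_i,\dots,X_p),$$ $$\imath_L\omega(X_0,\dots,X_p)=\sum_{i<j}(-1)^{i+j-1}\omega(L(X_i,X_j),X_0,\dots,\widehat{X_i},\dots,\widehat{X_j},\dots,X_p),$$ and both vanish on functions. Let $[\ ,\ ]$ be the Lie bracket of vector fields and $\mathrm d$ the exterior derivative. Let $\mathcal L_K=\imath_K\circ \mathrm d-\mathrm d\circ\imath_K$, and let $$T_K(X,Y)=[KX,KY]-K[KX,Y]-K[X,KY]+K^2[X,Y]$$ be the Nijenhuis torsion of $K$. Consider the degree one derivation $D=\mathcal L_K+\imath_L$ of $\Omega(M)$. 1. $D^2=0$ on $\Omega(M)$ if and only if $L(X,Y)=-K^{-1}T_K(X,Y)$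 for all vector fields $X,Y$ on $M$. 2. If $D^2=0$, then there is exactly one Lie algebroid structure $(TM,q,[\![\ ,\ ]\!])$ on the vector bundle $TM$ determined by $D$, i.e. such that $q(X)(f)=Df(X)$ and $$\alpha([\![X,Y]\!])=D(\alpha(Y))(X)-D(\alpha(X))(Y)-D\alpha(X,Y)$$ for all vector fields $X,Y$, all $f\in C^\infty(M)$ and all $\alpha\in\Omega^1(M)$. Its anchor is $q=K$, its bracket is $[\![X,Y]\!]=K^{-1}[KX,KY]$, and it is isomorphic (over the identity of $M$) to the trivial Lie algebroid $(TM,\mathrm{Id},[\ ,\ ])$. -/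

import Mathlib

open scoped Manifold ContDiff

noncomputable section

namespace TangentAlgebroid

section Pointwise

variable {E : Type*} [NormedAddCommGroup E] [NormedSpace ℝ E]

/-- The insertion `i_A η (v₁, …, v_k) = ∑ᵢ η (v₁, …, A vᵢ, …, v_k)` of an endomorphism into an
alternating form (see `insertEnd_apply`); it is zero on forms of degree `0`. -/
def insertEnd (A : E →L[ℝ] E) : (k : ℕ) → (E [⋀^Fin k]→L[ℝ] ℝ) → E [⋀^Fin k]→L[ℝ] ℝ
  | 0, _ => 0
  | _ + 1, η => .alternatizeUncurryFin (η.curryLeft ∘L A)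

/-- The insertion of an alternating bilinear map `B` (a vector-valued two-form) into an
alternating form,
`i_B η (v₀, …, v_k) = ∑_{i < j} (-1) ^ (i + j - 1) η (B (vᵢ, vⱼ), v₀, …, v̂ᵢ, …, v̂ⱼ, …, v_k)`,
that is, the signed sum over shuffles (see `insertBilin_apply`, where the pair `i < j` is encoded
as `(i.castSucc, j.succ)` with `i ≤ j`). It is written here as one half of an alternation, in which
each pair occurs twice. It is zero on forms of degree `0`. -/
def insertBilin (B : E →L[ℝ] E →L[ℝ] E) :
    (k : ℕ) → (E [⋀^Fin k]→L[ℝ] ℝ) → E [⋀^Fin (k + 1)]→L[ℝ] ℝ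
  | 0, _ => 0
  | k + 1, η => (1 / 2 : ℝ) • .alternatizeUncurryFin
      (ContinuousAlternatingMap.alternatizeUncurryFinCLM ℝ E ℝ ∘L
        (ContinuousLinearMap.compL ℝ E E (E [⋀^Fin k]→L[ℝ] ℝ) η.curryLeft ∘L B))

theorem insertEnd_apply (A : E →L[ℝ] E) (k : ℕ) (η : E [⋀^Fin (k + 1)]→L[ℝ] ℝ)
    (v : Fin (k + 1) → E) :
    insertEnd A (k + 1) η v = ∑ i, η (Function.update v i (A (v i))) := by
  simp only [insertEnd, ContinuousAlternatingMap.alternatizeUncurryFin_apply,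
    ContinuousLinearMap.comp_apply, ContinuousAlternatingMap.curryLeft_apply_apply]
  refine Finset.sum_congr rfl fun i _ => ?_
  rw [← Fin.insertNth_removeNth, ContinuousAlternatingMap.map_insertNth]

theorem insertBilin_apply (B : E →L[ℝ] E →L[ℝ] E) (hB : ∀ v, B v v = 0) (k : ℕ)
    (η : E [⋀^Fin (k + 1)]→L[ℝ] ℝ) (v : Fin (k + 2) → E) :
    insertBilin B (k + 1) η v = ∑ i : Fin (k + 1), ∑ j ≥ i, (-1) ^ (i + j : ℕ) *
      η (Matrix.vecCons (B (v i.castSucc) (v j.succ)) (j.removeNth (i.castSucc.removeNth v))) := by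
  have hs : ∀ u w, B w u = - B u w := by
    intro u w
    have := hB (u + w)
    simp only [map_add, _root_.add_apply, hB, zero_add, add_zero] at this
    exact eq_neg_of_add_eq_zero_right (by simpa [add_comm] using this)
  simp only [insertBilin, ContinuousAlternatingMap.smul_apply,
    ContinuousAlternatingMap.alternatizeUncurryFin_alternatizeUncurryFinCLM_comp_apply,
    Finset.smul_sum]
  refine Finset.sum_congr rfl fun i _ => Finset.sum_congr rfl fun j _ => ?_
  rw [show (ContinuousLinearMap.compL ℝ E E (E [⋀^Fin k]→L[ℝ] ℝ) η.curryLeft ∘L B)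
      (v j.succ) (v i.castSucc) = - (ContinuousLinearMap.compL ℝ E E (E [⋀^Fin k]→L[ℝ] ℝ)
        η.curryLeft ∘L B) (v i.castSucc) (v j.succ) by simp [hs (v i.castSucc) (v j.succ)]]
  simp
  ring

theorem contDiff_curryLeft {k : ℕ} :
    ContDiff ℝ ∞ (fun η : E [⋀^Fin (k + 1)]→L[ℝ] ℝ => η.curryLeft) := by
  refine IsBoundedLinearMap.contDiff (𝕜 := ℝ) (E := E [⋀^Fin (k + 1)]→L[ℝ] ℝ)
    (F := E →L[ℝ] E [⋀^Fin k]→L[ℝ] ℝ) ⟨⟨fun _ _ => rfl, fun _ _ => rfl⟩, 1, one_pos, fun η => ?_⟩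
  rw [one_mul, ContinuousAlternatingMap.norm_curryLeft]

theorem contDiff_constOfIsEmpty :
    ContDiff ℝ ∞ (fun c : ℝ => ContinuousAlternatingMap.constOfIsEmpty ℝ E (Fin 0) c) := by
  refine IsBoundedLinearMap.contDiff (𝕜 := ℝ) (F := E [⋀^Fin 0]→L[ℝ] ℝ)
    ⟨⟨fun _ _ => rfl, fun _ _ => rfl⟩, 1, one_pos, fun c => ?_⟩
  rw [one_mul]
  exact (ContinuousAlternatingMap.norm_constOfIsEmpty ℝ E (ι := Fin 0) c).le

theorem contDiffOn_compL {G : Type*} [NormedAddCommGroup G] [NormedSpace ℝ G]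
    {c : E → E →L[ℝ] G} {s : Set E} (hc : ContDiffOn ℝ ∞ c s) :
    ContDiffOn ℝ ∞ (fun y => ContinuousLinearMap.compL ℝ E E G (c y)) s := by
  have h : ContDiff ℝ ∞ (fun g : E →L[ℝ] G => ContinuousLinearMap.compL ℝ E E G g) := by
    fun_prop
  exact h.comp_contDiffOn hc

theorem contDiffOn_const_comp {G H : Type*} [NormedAddCommGroup G] [NormedSpace ℝ G]
    [NormedAddCommGroup H] [NormedSpace ℝ H] (T : G →L[ℝ] H)
    {c : E → E →L[ℝ] G} {s : Set E} (hc : ContDiffOn ℝ ∞ c s) :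
    ContDiffOn ℝ ∞ (fun y => T ∘L c y) s :=
  (contDiffOn_const (c := T)).clm_comp hc

theorem contDiffOn_insertEnd {A : E → E →L[ℝ] E} {k : ℕ} {η : E → E [⋀^Fin k]→L[ℝ] ℝ} {s : Set E}
    (hA : ContDiffOn ℝ ∞ A s) (hη : ContDiffOn ℝ ∞ η s) :
    ContDiffOn ℝ ∞ (fun y => insertEnd (A y) k (η y)) s := by
  cases k with
  | zero => exact contDiffOn_const
  | succ k =>
    have h1 : ContDiffOn ℝ ∞ (fun y => (η y).curryLeft) s :=
      contDiff_curryLeft.comp_contDiffOn hη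
    exact (ContinuousAlternatingMap.alternatizeUncurryFinCLM ℝ E ℝ).contDiff.comp_contDiffOn
      (h1.clm_comp hA)

theorem contDiffOn_insertBilin {B : E → E →L[ℝ] E →L[ℝ] E} {k : ℕ}
    {η : E → E [⋀^Fin k]→L[ℝ] ℝ} {s : Set E}
    (hB : ContDiffOn ℝ ∞ B s) (hη : ContDiffOn ℝ ∞ η s) :
    ContDiffOn ℝ ∞ (fun y => insertBilin (B y) k (η y)) s := by
  cases k with
  | zero => exact contDiffOn_const
  | succ k =>
    have h1 : ContDiffOn ℝ ∞ (fun y => (η y).curryLeft) s :=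
      contDiff_curryLeft.comp_contDiffOn hη
    have h2 := contDiffOn_compL h1
    have h3 := contDiffOn_const_comp
      (ContinuousAlternatingMap.alternatizeUncurryFinCLM ℝ E ℝ (n := k)) (h2.clm_comp hB)
    have h4 := (ContinuousAlternatingMap.alternatizeUncurryFinCLM ℝ E ℝ).contDiff.comp_contDiffOn h3
    exact h4.const_smul (1 / 2 : ℝ)

theorem insertEnd_comp (A P Q : E →L[ℝ] E) (hPQ : P ∘L Q = .id ℝ E) (k : ℕ)
    (η : E [⋀^Fin k]→L[ℝ] ℝ) :
    (insertEnd A k η).compContinuousLinearMap P =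
      insertEnd (Q ∘L A ∘L P) k (η.compContinuousLinearMap P) := by
  have h : ∀ u, P (Q u) = u := fun u => by simpa using congrArg (fun f => f u) hPQ
  cases k with
  | zero => ext; simp [insertEnd]
  | succ k =>
    ext v
    simp only [insertEnd_apply, ContinuousAlternatingMap.compContinuousLinearMap_apply]
    refine Finset.sum_congr rfl fun i _ => congrArg η ?_
    ext j
    by_cases hj : j = i
    · subst hj; simp [h]
    · simp [hj]

theorem curryLeft_comp {k : ℕ} (η : E [⋀^Fin (k + 1)]→L[ℝ] ℝ) (P Q : E →L[ℝ] E)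
    (hPQ : P ∘L Q = .id ℝ E) (u : E) :
    (η.curryLeft u).compContinuousLinearMap P = (η.compContinuousLinearMap P).curryLeft (Q u) := by
  have h : P (Q u) = u := by simpa using congrArg (fun f => f u) hPQ
  ext v
  simp only [ContinuousAlternatingMap.compContinuousLinearMap_apply,
    ContinuousAlternatingMap.curryLeft_apply_apply]
  congr 1
  ext l
  refine Fin.cases ?_ (fun l => ?_) l <;> simp [h]

theorem insertBilin_comp (B : E →L[ℝ] E →L[ℝ] E) (P : E →L[ℝ] E)
    (B' : E →L[ℝ] E →L[ℝ] E) (hB' : ∀ u w, P (B' u w) = B (P u) (P w)) (k : ℕ)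
    (η : E [⋀^Fin k]→L[ℝ] ℝ) :
    (insertBilin B k η).compContinuousLinearMap P =
      insertBilin B' k (η.compContinuousLinearMap P) := by
  cases k with
  | zero => ext; simp [insertBilin]
  | succ k =>
    ext v
    simp only [insertBilin, ContinuousAlternatingMap.compContinuousLinearMap_apply,
      ContinuousAlternatingMap.smul_apply,
      ContinuousAlternatingMap.alternatizeUncurryFin_alternatizeUncurryFinCLM_comp_apply]
    congr 1
    refine Finset.sum_congr rfl fun i _ => Finset.sum_congr rfl fun j _ => ?_
    simp [hB']
    rfl

end Pointwise

section Manifold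

variable (E : Type*) [NormedAddCommGroup E] [NormedSpace ℝ E]
  (M : Type*) [TopologicalSpace M] [ChartedSpace E M] [IsManifold 𝓘(ℝ, E) ∞ M]

/-- Smooth vector fields on `M`. -/
abbrev VField : Type _ := Cₛ^∞⟮𝓘(ℝ, E); E, (TangentSpace 𝓘(ℝ, E) : M → Type _)⟯

/-- Smooth endomorphisms of the vector bundle `TM`, i.e. smooth sections of `Hom (TM, TM)`;
equivalently, vector-valued one-forms. -/
abbrev EndTM : Type _ :=
  Cₛ^∞⟮𝓘(ℝ, E); E →L[ℝ] E,
    fun x : M => TangentSpace 𝓘(ℝ, E) x →L[ℝ] TangentSpace 𝓘(ℝ, E) x⟯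

/-- Vector-valued two-forms: smooth sections of the bundle of bilinear maps `TM × TM → TM` that
are alternating. -/
structure VectorTwoForm where
  toSection : Cₛ^∞⟮𝓘(ℝ, E); E →L[ℝ] E →L[ℝ] E, fun x : M =>
    TangentSpace 𝓘(ℝ, E) x →L[ℝ] TangentSpace 𝓘(ℝ, E) x →L[ℝ] TangentSpace 𝓘(ℝ, E) x⟯
  map_self : ∀ (x : M) (v : TangentSpace 𝓘(ℝ, E) x), toSection x v v = 0

variable {E M}

/-- The expression of a (not necessarily smooth) differential form in the chart at `x₀`, that is,
its pullback under the inverse of the chart. -/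
def inChart {k : ℕ} (α : ∀ x : M, TangentSpace 𝓘(ℝ, E) x [⋀^Fin k]→L[ℝ] ℝ) (x₀ : M) (y : E) :
    E [⋀^Fin k]→L[ℝ] ℝ :=
  (α ((extChartAt 𝓘(ℝ, E) x₀).symm y)).compContinuousLinearMap
    (mfderiv 𝓘(ℝ, E) 𝓘(ℝ, E) (extChartAt 𝓘(ℝ, E) x₀).symm y)

variable (E M) in
/-- The space `Ω^k(M)` of smooth differential `k`-forms: families of alternating `k`-linear forms on
the tangent spaces whose expressions in the charts are smooth. -/
def DiffForm (k : ℕ) : Submodule ℝ (∀ x : M, TangentSpace 𝓘(ℝ, E) x [⋀^Fin k]→L[ℝ] ℝ) where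
  carrier := {α | ∀ x₀ : M, ContDiffOn ℝ ∞ (inChart α x₀) (extChartAt 𝓘(ℝ, E) x₀).target}
  add_mem' hα hβ x₀ := (hα x₀).add (hβ x₀)
  zero_mem' _ := (contDiffOn_const (c := (0 : E [⋀^Fin k]→L[ℝ] ℝ))).congr fun _ _ => rfl
  smul_mem' c _ hα x₀ := (hα x₀).const_smul c

/-- The derivative of the chart at `x₀`, at the point `x`. -/
def chartDAt (x₀ x : M) : E →L[ℝ] E :=
  mfderiv 𝓘(ℝ, E) 𝓘(ℝ, E) (extChartAt 𝓘(ℝ, E) x₀) x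

/-- The derivative of the chart at `x₀`, at the point with coordinates `y`. -/
def chartD (x₀ : M) (y : E) : E →L[ℝ] E :=
  mfderiv 𝓘(ℝ, E) 𝓘(ℝ, E) (extChartAt 𝓘(ℝ, E) x₀) ((extChartAt 𝓘(ℝ, E) x₀).symm y)

/-- The derivative of the inverse of the chart at `x₀`, at the point with coordinates `y`. -/
def chartDInv (x₀ : M) (y : E) : E →L[ℝ] E :=
  mfderiv 𝓘(ℝ, E) 𝓘(ℝ, E) (extChartAt 𝓘(ℝ, E) x₀).symm y

theorem chartDInv_comp (x₀ : M) {y : E} (hy : y ∈ (extChartAt 𝓘(ℝ, E) x₀).target) :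
    chartDInv x₀ y ∘L chartD x₀ y = .id ℝ E := by
  have : IsManifold 𝓘(ℝ, E) 1 M := .of_le (n := ∞) (by simp)
  have h := mfderivWithin_extChartAt_symm_comp_mfderiv_extChartAt (I := 𝓘(ℝ, E)) (x := x₀) hy
  rw [ModelWithCorners.range_eq_univ, mfderivWithin_univ] at h
  exact h

theorem chartD_comp (x₀ : M) {y : E} (hy : y ∈ (extChartAt 𝓘(ℝ, E) x₀).target) :
    chartD x₀ y ∘L chartDInv x₀ y = .id ℝ E := by
  have : IsManifold 𝓘(ℝ, E) 1 M := .of_le (n := ∞) (by simp)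
  have h := mfderiv_extChartAt_comp_mfderivWithin_extChartAt_symm (I := 𝓘(ℝ, E)) (x := x₀) hy
  rw [ModelWithCorners.range_eq_univ, mfderivWithin_univ] at h
  exact h


theorem contMDiffOn_chartDInv (x₀ : M) (u : E) :
    ContMDiffOn 𝓘(ℝ, E) (𝓘(ℝ, E).prod 𝓘(ℝ, E)) ∞
      (fun x : M => Bundle.TotalSpace.mk' E (E := (TangentSpace 𝓘(ℝ, E) : M → Type _)) x
        (show TangentSpace 𝓘(ℝ, E) x from chartDInv x₀ (extChartAt 𝓘(ℝ, E) x₀ x) u))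
      (chartAt E x₀).source := by
  have : IsManifold 𝓘(ℝ, E) 1 M := .of_le (n := ∞) (by simp)
  let e := trivializationAt E (TangentSpace 𝓘(ℝ, E)) x₀
  have h1 : ContMDiffOn 𝓘(ℝ, E) (𝓘(ℝ, E).prod 𝓘(ℝ, E)) ∞
      (fun x : M => Bundle.TotalSpace.mk' E (E := (TangentSpace 𝓘(ℝ, E) : M → Type _)) x
        (e.symmL ℝ x u)) e.baseSet := by
    rw [e.contMDiffOn_section_baseSet_iff]
    refine (contMDiffOn_const (c := u)).congr fun x hx => ?_
    simp [e.symmL_apply hx, e.mk_symm hx, e.apply_symm_apply' hx]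
  refine h1.congr fun x hx => ?_
  have h := TangentBundle.symmL_trivializationAt (I := 𝓘(ℝ, E)) (x₀ := x₀) (x := x) hx
  rw [ModelWithCorners.range_eq_univ, mfderivWithin_univ] at h
  exact congrArg (fun f : E →L[ℝ] E => Bundle.TotalSpace.mk' E
    (E := (TangentSpace 𝓘(ℝ, E) : M → Type _)) x (f u)) h.symm

theorem contDiffOn_chartD {X : ∀ x : M, TangentSpace 𝓘(ℝ, E) x} (x₀ : M)
    (hX : ContMDiffOn 𝓘(ℝ, E) (𝓘(ℝ, E).prod 𝓘(ℝ, E)) ∞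
      (fun x : M => Bundle.TotalSpace.mk' E (E := (TangentSpace 𝓘(ℝ, E) : M → Type _)) x (X x))
      (chartAt E x₀).source) :
    ContDiffOn ℝ ∞ (fun y => chartD x₀ y (X ((extChartAt 𝓘(ℝ, E) x₀).symm y)))
      (extChartAt 𝓘(ℝ, E) x₀).target := by
  have : IsManifold 𝓘(ℝ, E) 1 M := .of_le (n := ∞) (by simp)
  let e := trivializationAt E (TangentSpace 𝓘(ℝ, E)) x₀
  have hX' := (e.contMDiffOn_section_baseSet_iff (IB := 𝓘(ℝ, E)) (n := ∞) (s := X)).1 hX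
  rw [← contMDiffOn_iff_contDiffOn]
  have hm : ∀ y ∈ (extChartAt 𝓘(ℝ, E) x₀).target,
      (extChartAt 𝓘(ℝ, E) x₀).symm y ∈ e.baseSet := fun y hy => by
    have := (extChartAt 𝓘(ℝ, E) x₀).map_target hy
    rwa [extChartAt_source] at this
  refine (hX'.comp (contMDiffOn_extChartAt_symm x₀) hm).congr fun y hy => ?_
  have h := TangentBundle.continuousLinearMapAt_trivializationAt (I := 𝓘(ℝ, E)) (x₀ := x₀)
    (hm y hy)
  refine (congrArg (fun f : E →L[ℝ] E => f (X ((extChartAt 𝓘(ℝ, E) x₀).symm y))) h.symm).trans ?_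
  exact congrFun (e.coe_linearMapAt_of_mem (R := ℝ) (hm y hy)) _


/-- The exterior derivative of a smooth form, computed at `x` in the chart at `x`. -/
def rawExtD {k : ℕ} (α : DiffForm E M k) (x : M) :
    TangentSpace 𝓘(ℝ, E) x [⋀^Fin (k + 1)]→L[ℝ] ℝ :=
  (extDeriv (inChart α.1 x) (extChartAt 𝓘(ℝ, E) x x)).compContinuousLinearMap
    (mfderiv 𝓘(ℝ, E) 𝓘(ℝ, E) (extChartAt 𝓘(ℝ, E) x) x)

/-- The exterior derivative may be computed in any chart. -/
theorem inChart_rawExtD {k : ℕ} (α : DiffForm E M k) (x₀ : M) {y : E}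
    (hy : y ∈ (extChartAt 𝓘(ℝ, E) x₀).target) :
    inChart (rawExtD α) x₀ y = extDeriv (inChart α.1 x₀) y := by
  have : IsManifold 𝓘(ℝ, E) 1 M := .of_le (n := ∞) (by simp)
  set φ₀ := extChartAt 𝓘(ℝ, E) x₀ with hφ₀
  set x : M := φ₀.symm y with hx
  set φ := extChartAt 𝓘(ℝ, E) x with hφ
  let a : M → E [⋀^Fin k]→L[ℝ] ℝ := α.1
  let f : E → E := fun z => φ (φ₀.symm z)
  have hsymm : ContMDiffOn 𝓘(ℝ, E) 𝓘(ℝ, E) ∞ φ₀.symm φ₀.target := contMDiffOn_extChartAt_symm x₀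
  have ht : φ₀.target ∈ nhds y := (isOpen_extChartAt_target x₀).mem_nhds hy
  have hxs : x ∈ φ.source := mem_extChartAt_source x
  have hs : φ₀.target ∩ φ₀.symm ⁻¹' φ.source ∈ nhds y :=
    Filter.inter_mem ht ((hsymm.contMDiffAt ht).continuousAt.preimage_mem_nhds
      ((isOpen_extChartAt_source x).mem_nhds hxs))
  have hfd : ∀ z ∈ φ₀.target ∩ φ₀.symm ⁻¹' φ.source, fderiv ℝ f z =
      chartDAt x (φ₀.symm z) ∘L chartDInv x₀ z := by
    intro z hz
    have h1 : MDifferentiableAt 𝓘(ℝ, E) 𝓘(ℝ, E) φ₀.symm z :=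
      (hsymm.contMDiffAt ((isOpen_extChartAt_target x₀).mem_nhds hz.1)).mdifferentiableAt (by simp)
    have h2 : MDifferentiableAt 𝓘(ℝ, E) 𝓘(ℝ, E) φ (φ₀.symm z) :=
      mdifferentiableAt_extChartAt (by have := hz.2; rwa [Set.mem_preimage, extChartAt_source] at this)
    have h3 := mfderiv_comp z h2 h1
    rw [mfderiv_eq_fderiv] at h3
    exact h3
  have hf : ContDiffAt ℝ ∞ f y := by
    rw [← contMDiffAt_iff_contDiffAt]
    exact ContMDiffAt.comp y (contMDiffAt_extChartAt (I := 𝓘(ℝ, E)) (n := ∞) (x := x))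
      (hsymm.contMDiffAt ht)
  have hform : ∀ z ∈ φ₀.target ∩ φ₀.symm ⁻¹' φ.source,
      inChart α.1 x₀ z = (inChart α.1 x (f z)).compContinuousLinearMap (fderiv ℝ f z) := by
    intro z hz
    have e1 : φ.symm (f z) = φ₀.symm z := φ.left_inv hz.2
    have e2 : chartDInv x (f z) ∘L chartDAt x (φ₀.symm z) =
        .id ℝ E := by
      have h := mfderivWithin_extChartAt_symm_comp_mfderiv_extChartAt' (I := 𝓘(ℝ, E)) (x := x) hz.2
      rw [ModelWithCorners.range_eq_univ, mfderivWithin_univ] at h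
      exact h
    have e3 : chartDInv x (f z) ∘L fderiv ℝ f z = chartDInv x₀ z := by
      rw [hfd z hz, ← ContinuousLinearMap.comp_assoc, e2, ContinuousLinearMap.id_comp]
    calc inChart α.1 x₀ z = (a (φ₀.symm z)).compContinuousLinearMap (chartDInv x₀ z) := rfl
      _ = (a (φ.symm (f z))).compContinuousLinearMap (chartDInv x (f z) ∘L fderiv ℝ f z) := by
        rw [e1, e3]
      _ = _ := rfl
  have hev : inChart α.1 x₀ =ᶠ[nhds y]
      fun z => (inChart α.1 x (f z)).compContinuousLinearMap (fderiv ℝ f z) :=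
    Filter.eventually_of_mem hs hform
  have hd : DifferentiableAt ℝ (inChart α.1 x) (f y) :=
    ((α.2 x).contDiffAt ((isOpen_extChartAt_target x).mem_nhds
      (mem_extChartAt_target x))).differentiableAt (by simp)
  rw [hev.extDeriv_eq, extDeriv_pullback hd hf (by simpa using (ENat.LEInfty.out : (2 : ℕ∞ω) ≤ ∞)), hfd y (mem_of_mem_nhds hs)]
  rfl

/-- The exterior derivative `d : Ω^k(M) → Ω^{k+1}(M)`. -/
def extD {k : ℕ} (α : DiffForm E M k) : DiffForm E M (k + 1) :=
  ⟨rawExtD α, fun x₀ => by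
    refine ContDiffOn.congr ?_ fun y hy => inChart_rawExtD α x₀ hy
    have h := (α.2 x₀).fderiv_of_isOpen (m := ∞) (isOpen_extChartAt_target x₀) (by simp)
    exact (ContinuousAlternatingMap.alternatizeUncurryFinCLM ℝ E ℝ).contDiff.comp_contDiffOn h⟩

theorem mdifferentiableAt_field (X : VField E M) (x : M) :
    MDifferentiableAt 𝓘(ℝ, E) (𝓘(ℝ, E).prod 𝓘(ℝ, E))
      (fun x : M => Bundle.TotalSpace.mk' E (E := (TangentSpace 𝓘(ℝ, E) : M → Type _)) x (X x)) x :=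
  X.contMDiff.contMDiffAt.mdifferentiableAt (by simp)

variable (E M) in
theorem isManifold_two : IsManifold 𝓘(ℝ, E) (minSmoothness ℝ 2) M :=
  .of_le (n := ∞) (by simpa using (ENat.LEInfty.out : (2 : ℕ∞ω) ≤ ∞))

variable [FiniteDimensional ℝ E]

/-- The expression of an endomorphism of `TM` in the chart at `x₀`. -/
def endInChart (K : EndTM E M) (x₀ : M) (y : E) : E →L[ℝ] E :=
  chartD x₀ y ∘L (show E →L[ℝ] E from K ((extChartAt 𝓘(ℝ, E) x₀).symm y)) ∘L chartDInv x₀ y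

theorem contDiffOn_endInChart (K : EndTM E M) (x₀ : M) :
    ContDiffOn ℝ ∞ (endInChart K x₀) (extChartAt 𝓘(ℝ, E) x₀).target := by
  rw [contDiffOn_clm_apply]
  intro u
  have h := contDiffOn_chartD x₀ (K.contMDiff.contMDiffOn.clm_bundle_apply
    (contMDiffOn_chartDInv x₀ u))
  refine h.congr fun y hy => ?_
  rw [(extChartAt 𝓘(ℝ, E) x₀).right_inv hy]
  rfl

/-- The expression of a vector-valued two-form in the chart at `x₀`. -/
def bilinInChart (L : VectorTwoForm E M) (x₀ : M) (y : E) : E →L[ℝ] E →L[ℝ] E :=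
  ContinuousLinearMap.bilinearComp
    (ContinuousLinearMap.compL ℝ E E E (chartD x₀ y) ∘L
      (show E →L[ℝ] E →L[ℝ] E from L.toSection ((extChartAt 𝓘(ℝ, E) x₀).symm y)))
    (chartDInv x₀ y) (chartDInv x₀ y)

theorem contDiffOn_bilinInChart (L : VectorTwoForm E M) (x₀ : M) :
    ContDiffOn ℝ ∞ (bilinInChart L x₀) (extChartAt 𝓘(ℝ, E) x₀).target := by
  rw [contDiffOn_clm_apply]
  intro u
  rw [contDiffOn_clm_apply]
  intro w
  have h := contDiffOn_chartD x₀ (L.toSection.contMDiff.contMDiffOn.clm_bundle_apply₂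
    (contMDiffOn_chartDInv x₀ u) (contMDiffOn_chartDInv x₀ w))
  refine h.congr fun y hy => ?_
  rw [(extChartAt 𝓘(ℝ, E) x₀).right_inv hy]
  rfl

/-- The insertion `i_K : Ω^k(M) → Ω^k(M)` of an endomorphism `K` of `TM`. -/
def iotaEnd (K : EndTM E M) {k : ℕ} (α : DiffForm E M k) : DiffForm E M k :=
  ⟨fun x => insertEnd (E := E) (K x) k (α.1 x), fun x₀ => by
    refine (contDiffOn_insertEnd (contDiffOn_endInChart K x₀) (α.2 x₀)).congr fun y hy => ?_
    exact insertEnd_comp (E := E) _ (chartDInv x₀ y) (chartD x₀ y) (chartDInv_comp x₀ hy) k _⟩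

/-- The insertion `i_L : Ω^k(M) → Ω^{k+1}(M)` of a vector-valued two-form `L`. -/
def iotaTwo (L : VectorTwoForm E M) {k : ℕ} (α : DiffForm E M k) : DiffForm E M (k + 1) :=
  ⟨fun x => insertBilin (E := E) (L.toSection x) k (α.1 x), fun x₀ => by
    refine (contDiffOn_insertBilin (contDiffOn_bilinInChart L x₀) (α.2 x₀)).congr fun y hy => ?_
    refine insertBilin_comp (E := E) _ (chartDInv x₀ y) _ (fun u w => ?_) k _
    exact congrArg (fun f : E →L[ℝ] E => f _) (chartDInv_comp x₀ hy)⟩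

/-- The contraction `α ↦ α (X, ·, …, ·)` of a form with a vector field. -/
def interior (X : VField E M) {k : ℕ} (α : DiffForm E M (k + 1)) : DiffForm E M k :=
  ⟨fun x => ContinuousAlternatingMap.curryLeft (E := E) (α.1 x) (X x), fun x₀ => by
    refine ((contDiff_curryLeft.comp_contDiffOn (α.2 x₀)).clm_apply
      (contDiffOn_chartD x₀ X.contMDiff.contMDiffOn)).congr fun y hy => ?_
    exact curryLeft_comp (E := E) _ (chartDInv x₀ y) (chartD x₀ y) (chartDInv_comp x₀ hy) _⟩

/-- A smooth function, regarded as a differential form of degree `0`. -/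
def ofFun (f : C^∞⟮𝓘(ℝ, E), M; ℝ⟯) : DiffForm E M 0 :=
  ⟨fun x => ContinuousAlternatingMap.constOfIsEmpty ℝ (TangentSpace 𝓘(ℝ, E) x) (Fin 0) (f x),
    fun x₀ => by
    have h1 : ContDiffOn ℝ ∞ (fun y => f ((extChartAt 𝓘(ℝ, E) x₀).symm y))
        (extChartAt 𝓘(ℝ, E) x₀).target :=
      contMDiffOn_iff_contDiffOn.1 (f.contMDiff.comp_contMDiffOn (contMDiffOn_extChartAt_symm x₀))
    refine (contDiff_constOfIsEmpty.comp_contDiffOn h1).congr fun y _ => ?_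
    rfl⟩

/-- The Lie derivative `𝓛_K = [i_K, d] = i_K ∘ d - d ∘ i_K` along the vector-valued one-form `K`. -/
def lieDer (K : EndTM E M) {k : ℕ} (α : DiffForm E M k) : DiffForm E M (k + 1) :=
  iotaEnd K (extD α) - extD (iotaEnd K α)

/-- The degree one derivation `D = 𝓛_K + i_L` of `Ω(M)`, on forms of degree `k`. -/
def fnDer (K : EndTM E M) (L : VectorTwoForm E M) {k : ℕ} (α : DiffForm E M k) :
    DiffForm E M (k + 1) :=
  lieDer K α + iotaTwo L α

/-- The vector field `K X`. -/
def applyEnd (K : EndTM E M) (X : VField E M) : VField E M :=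
  ⟨fun x => K x (X x), K.contMDiff.clm_bundle_apply X.contMDiff⟩

/-- The vector field `f X`. -/
def mulField (f : C^∞⟮𝓘(ℝ, E), M; ℝ⟯) (X : VField E M) : VField E M :=
  ⟨fun x => f x • X x, f.contMDiff.smul_section X.contMDiff⟩

/-- The derivative `X f` at the point `x`. -/
def dirDeriv (X : VField E M) (f : C^∞⟮𝓘(ℝ, E), M; ℝ⟯) (x : M) : ℝ :=
  mfderiv 𝓘(ℝ, E) 𝓘(ℝ, ℝ) f x (X x)

/-- The Lie bracket `[X, Y]` of vector fields. -/
def lieBracket (X Y : VField E M) : VField E M :=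
  ⟨VectorField.mlieBracket 𝓘(ℝ, E) X Y, by
    have : CompleteSpace E := FiniteDimensional.complete ℝ E
    have := isManifold_two E M
    have : IsManifold 𝓘(ℝ, E) ((⊤ : ℕ∞) + 1) M := inferInstanceAs (IsManifold 𝓘(ℝ, E) ∞ M)
    exact fun x => ContMDiffAt.mlieBracket_vectorField (n := ⊤) (m := ⊤) (X.contMDiff x)
      (Y.contMDiff x) (by simp)⟩

/-- The Nijenhuis torsion
`T_K (X, Y) = [K X, K Y] - K [K X, Y] - K [X, K Y] + K² [X, Y]`. -/
def torsion (K : EndTM E M) (X Y : VField E M) : VField E M :=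
  lieBracket (applyEnd K X) (applyEnd K Y) - applyEnd K (lieBracket (applyEnd K X) Y)
    - applyEnd K (lieBracket X (applyEnd K Y)) + applyEnd K (applyEnd K (lieBracket X Y))

variable (E M) in
/-- A Lie algebroid structure on the vector bundle `TM`: a vector bundle map `TM → TM` over `M`
(the anchor) and a Lie bracket on the space of sections of `TM` satisfying the Leibniz rule. -/
@[ext]
structure LieAlgebroidTM where
  anchor : EndTM E M
  bracket : VField E M →ₗ[ℝ] VField E M →ₗ[ℝ] VField E M
  bracket_self : ∀ X, bracket X X = 0
  jacobi : ∀ X Y Z, bracket X (bracket Y Z) = bracket (bracket X Y) Z + bracket Y (bracket X Z)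
  leibniz : ∀ X Y (f : C^∞⟮𝓘(ℝ, E), M; ℝ⟯) (x : M),
    bracket X (mulField f Y) x = f x • bracket X Y x + dirDeriv (applyEnd anchor X) f x • Y x

variable (E M) in
/-- The identity endomorphism of `TM`. -/
def idTM : EndTM E M :=
  ⟨fun x => ContinuousLinearMap.id ℝ (TangentSpace 𝓘(ℝ, E) x), fun x₀ => by
    rw [contMDiffAt_hom_bundle]
    refine ⟨contMDiffAt_id, ?_⟩
    refine (contMDiffAt_const (c := ContinuousLinearMap.id ℝ E)).congr_of_eventuallyEq ?_
    filter_upwards [(chartAt E x₀).open_source.mem_nhds (mem_chart_source E x₀)] with x hx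
    rw [ContinuousLinearMap.inCoordinates_eq hx hx]
    ext v
    simp⟩

variable (E M) in
/-- The Lie bracket of vector fields as a bilinear map. -/
def lieBracketBilin : VField E M →ₗ[ℝ] VField E M →ₗ[ℝ] VField E M :=
  LinearMap.mk₂ ℝ lieBracket
    (fun X X' Y => by
      have := isManifold_two E M
      have : CompleteSpace E := FiniteDimensional.complete ℝ E
      ext x
      exact VectorField.mlieBracket_add_left (mdifferentiableAt_field X x)
        (mdifferentiableAt_field X' x))
    (fun c X Y => by
      have := isManifold_two E M
      have : CompleteSpace E := FiniteDimensional.complete ℝ E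
      ext x
      exact VectorField.mlieBracket_const_smul_left (mdifferentiableAt_field X x))
    (fun X Y Y' => by
      have := isManifold_two E M
      have : CompleteSpace E := FiniteDimensional.complete ℝ E
      ext x
      exact VectorField.mlieBracket_add_right (mdifferentiableAt_field Y x)
        (mdifferentiableAt_field Y' x))
    (fun c X Y => by
      have := isManifold_two E M
      have : CompleteSpace E := FiniteDimensional.complete ℝ E
      ext x
      exact VectorField.mlieBracket_const_smul_right (mdifferentiableAt_field Y x))

variable (E M) in
/-- The trivial Lie algebroid `(TM, Id, [ , ])`. -/
def trivialAlgebroid : LieAlgebroidTM E M where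
  anchor := idTM E M
  bracket := lieBracketBilin E M
  bracket_self X := by
    ext x
    exact congrFun (VectorField.mlieBracket_self (I := 𝓘(ℝ, E)) (V := ⇑X)) x
  jacobi X Y Z := by
    have : IsManifold 𝓘(ℝ, E) (minSmoothness ℝ 3) M := .of_le (n := ∞) (by
      simpa using (ENat.LEInfty.out : (3 : ℕ∞ω) ≤ ∞))
    have : CompleteSpace E := FiniteDimensional.complete ℝ E
    have h2 : minSmoothness ℝ 2 ≤ ∞ := by simpa using (ENat.LEInfty.out : (2 : ℕ∞ω) ≤ ∞)
    ext x
    exact VectorField.leibniz_identity_mlieBracket_apply (X.contMDiff.contMDiffAt.of_le h2)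
      (Y.contMDiff.contMDiffAt.of_le h2) (Z.contMDiff.contMDiffAt.of_le h2)
  leibniz X Y f x := by
    have := isManifold_two E M
    have : CompleteSpace E := FiniteDimensional.complete ℝ E
    have h := VectorField.mlieBracket_smul_right (I := 𝓘(ℝ, E)) (V := ⇑X) (W := ⇑Y)
      (f.contMDiff.contMDiffAt.mdifferentiableAt (by simp) : MDifferentiableAt _ _ f x)
      (mdifferentiableAt_field Y x)
    exact h.trans (add_comm _ _)

/-- An isomorphism of Lie algebroid structures on `TM` (over the identity of `M`): an isomorphism of
the vector bundle `TM` that is compatible with the anchors and the brackets. The inverse of a smooth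
fibrewise invertible bundle map is again smooth. -/
structure LieAlgebroidTM.Iso (𝓐 𝓑 : LieAlgebroidTM E M) where
  toEnd : EndTM E M
  isInvertible : ∀ x, (toEnd x).IsInvertible
  anchor_comp : ∀ (x : M) (v : TangentSpace 𝓘(ℝ, E) x), 𝓑.anchor x (toEnd x v) = 𝓐.anchor x v
  map_bracket : ∀ X Y,
    applyEnd toEnd (𝓐.bracket X Y) = 𝓑.bracket (applyEnd toEnd X) (applyEnd toEnd Y)

/-- The Lie algebroid structure `𝓐` on `TM`, with anchor `q` and bracket `⟦ , ⟧`, is the one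
determined by the degree one derivation `D` of `Ω(M)`:
`q(X)(f) = Df (X)` for all functions `f`, and
`α (⟦X, Y⟧) = D(α(Y)) (X) - D(α(X)) (Y) - Dα (X, Y)` for all one-forms `α`. -/
structure LieAlgebroidTM.IsDeterminedBy (𝓐 : LieAlgebroidTM E M)
    (D : ∀ {k : ℕ}, DiffForm E M k → DiffForm E M (k + 1)) : Prop where
  anchor_eq : ∀ (X : VField E M) (f : C^∞⟮𝓘(ℝ, E), M; ℝ⟯) (x : M),
    dirDeriv (applyEnd 𝓐.anchor X) f x = (D (ofFun f)).1 x ![X x]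
  bracket_eq : ∀ (X Y : VField E M) (α : DiffForm E M 1) (x : M),
    α.1 x ![𝓐.bracket X Y x] =
      (D (interior Y α)).1 x ![X x] - (D (interior X α)).1 x ![Y x] - (D α).1 x ![X x, Y x]

end Manifold
end TangentAlgebroid
end

noncomputable section

namespace TangentAlgebroid

/-! ### Insertion operators on alternating forms. -/

section LinearAlgebra

variable {E : Type*} [NormedAddCommGroup E] [NormedSpace ℝ E]

/-! Pullback by the invertible endomorphism, `K^* α = α (K ·, …, K ·)`, is an automorphism of the
algebra of forms, so `K^* ∘ d ∘ (K^*)⁻¹` is a derivation of degree one and square zero. On functions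
it is `f ↦ df ∘ K`, as is `D`; hence the two differ by the insertion of a vector-valued two-form.
Computing it gives `D ∘ K^* = K^* ∘ d + i_S ∘ K^*` with `S = L + K⁻¹ T_K`. This is
`localDer_pullback`, proved in a chart, with `apply_skewSource_sub_flip` identifying the torsion.

If `S = 0`, then `D` is conjugate to `d`, so `D² = 0` (`fnDer_fnDer_eq_zero`). Conversely, on a
function `D² f = i_S (K^* df)`, that is `df ∘ (K L + T_K)` (`fderiv_eq_zero_of_fnDer_fnDer`); since
differentials of global functions separate tangent vectors (`eq_zero_of_forall_mfderiv_eq_zero`),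
`D² = 0` forces `S = 0`.

The algebroid is then the trivial one transported along `K`, and `K` itself is the isomorphism. That
`D` determines it is a coordinate computation (`apply_bracket_eq_localDer`). Uniqueness again uses
that differentials of functions separate vectors. -/

theorem insertEnd_apply' (A : E →L[ℝ] E) (k : ℕ) (η : E [⋀^Fin k]→L[ℝ] ℝ) (v : Fin k → E) :
    insertEnd A k η v = ∑ i, η (Function.update v i (A (v i))) := by
  cases k with
  | zero => simp [insertEnd]
  | succ k => exact insertEnd_apply A k η v

theorem insertEnd_add_left (A A' : E →L[ℝ] E) (k : ℕ) (η : E [⋀^Fin k]→L[ℝ] ℝ) :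
    insertEnd (A + A') k η = insertEnd A k η + insertEnd A' k η := by
  ext v
  simp [insertEnd_apply', Finset.sum_add_distrib]

theorem insertEnd_sub_left (A A' : E →L[ℝ] E) (k : ℕ) (η : E [⋀^Fin k]→L[ℝ] ℝ) :
    insertEnd (A - A') k η = insertEnd A k η - insertEnd A' k η := by
  rw [eq_sub_iff_add_eq, ← insertEnd_add_left, sub_add_cancel]

/-- The insertion of an endomorphism into an alternation acts on the alternated slot and on the
remaining slots. -/
theorem insertEnd_alternatizeUncurryFin (A : E →L[ℝ] E) (k : ℕ)
    (f : E →L[ℝ] E [⋀^Fin k]→L[ℝ] ℝ) (v : Fin (k + 1) → E) :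
    insertEnd A (k + 1) (.alternatizeUncurryFin f) v = ∑ i : Fin (k + 1), (-1 : ℤ) ^ (i : ℕ) •
      (f (A (v i)) (i.removeNth v) + insertEnd A k (f (v i)) (i.removeNth v)) := by
  simp only [insertEnd_apply', ContinuousAlternatingMap.alternatizeUncurryFin_apply]
  rw [Finset.sum_comm]
  refine Finset.sum_congr rfl fun i _ => ?_
  rw [← Finset.smul_sum, Fin.sum_univ_succAbove _ i]
  congr 2
  · simp
  · refine Finset.sum_congr rfl fun j _ => ?_
    rw [Function.update_of_ne (Fin.ne_succAbove i j)]
    congr 1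
    ext l
    simp [Fin.removeNth, Function.update_apply]

theorem insertBilin_zero_left (k : ℕ) (η : E [⋀^Fin k]→L[ℝ] ℝ) : insertBilin 0 k η = 0 := by
  cases k with
  | zero => rfl
  | succ k =>
    simp [insertBilin, ← ContinuousAlternatingMap.alternatizeUncurryFinCLM_apply]

theorem insertBilin_add_left (B B' : E →L[ℝ] E →L[ℝ] E) (k : ℕ) (η : E [⋀^Fin k]→L[ℝ] ℝ) :
    insertBilin (B + B') k η = insertBilin B k η + insertBilin B' k η := by
  cases k with
  | zero => simp [insertBilin]
  | succ k =>
    simp only [insertBilin, ContinuousLinearMap.comp_add,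
      ContinuousAlternatingMap.alternatizeUncurryFin_add, smul_add]

/-- Alternating the insertions of `C u` gives the insertion of the skew part of `C`. -/
theorem sum_insertEnd_eq_insertBilin (C : E →L[ℝ] E →L[ℝ] E) (k : ℕ) (η : E [⋀^Fin k]→L[ℝ] ℝ)
    (v : Fin (k + 1) → E) :
    ∑ i : Fin (k + 1), (-1 : ℤ) ^ (i : ℕ) • insertEnd (C (v i)) k η (i.removeNth v) =
      insertBilin (C - C.flip) k η v := by
  cases k with
  | zero => simp [insertBilin, insertEnd]
  | succ k =>
    -- The left side is a double alternation, which depends only on the skew part of `C`. Replacing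
    -- `C` by `C - C.flip` doubles it, and the factor `1 / 2` in `insertBilin` compensates.
    have h := ContinuousAlternatingMap.alternatizeUncurryFin_apply
      (ContinuousAlternatingMap.alternatizeUncurryFinCLM ℝ E ℝ ∘L
        (ContinuousLinearMap.compL ℝ E E (E [⋀^Fin k]→L[ℝ] ℝ) η.curryLeft ∘L C)) v
    refine h.symm.trans ?_
    simp only [insertBilin, ContinuousAlternatingMap.smul_apply,
      ContinuousAlternatingMap.alternatizeUncurryFin_alternatizeUncurryFinCLM_comp_apply,
      Finset.smul_sum]
    refine Finset.sum_congr rfl fun i _ => Finset.sum_congr rfl fun j _ => ?_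
    simp [ContinuousLinearMap.flip_apply]
    ring

theorem insertBilin_one_apply (B : E →L[ℝ] E →L[ℝ] E) (hB : ∀ v, B v v = 0)
    (η : E [⋀^Fin 1]→L[ℝ] ℝ) (u w : E) :
    insertBilin B 1 η ![u, w] = η ![B u w] := by
  rw [insertBilin_apply B hB]
  simp

end LinearAlgebra

/-! ### The derivation, its conjugation to `d`, and the torsion on an open set of a vector space. -/

section Calculus

variable {E : Type*} [NormedAddCommGroup E] [NormedSpace ℝ E]

theorem hasFDerivAt_clm_comp {F G : Type*} [NormedAddCommGroup F] [NormedSpace ℝ F]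
    [NormedAddCommGroup G] [NormedSpace ℝ G] (c : F →L[ℝ] G) {f : E → F} {x : E}
    (hf : DifferentiableAt ℝ f x) : HasFDerivAt (fun y => c (f y)) (c ∘L fderiv ℝ f x) x :=
  c.hasFDerivAt.comp x hf.hasFDerivAt

/-- Product rule: insertion is bilinear in the endomorphism and the form, being a composition
followed by the linear operation of alternation. -/
theorem hasFDerivAt_insertEnd {A : E → E →L[ℝ] E} {k : ℕ} {η : E → E [⋀^Fin k]→L[ℝ] ℝ} {x : E}
    (hA : DifferentiableAt ℝ A x) (hη : DifferentiableAt ℝ η x) :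
    ∃ T : E →L[ℝ] E [⋀^Fin k]→L[ℝ] ℝ, HasFDerivAt (fun y => insertEnd (A y) k (η y)) T x ∧
      ∀ u, T u = insertEnd (fderiv ℝ A x u) k (η x) + insertEnd (A x) k (fderiv ℝ η x u) := by
  cases k with
  | zero => exact ⟨0, hasFDerivAt_const _ _, fun u => by simp [insertEnd]⟩
  | succ k =>
    have h1 := hasFDerivAt_clm_comp (G := E →L[ℝ] E [⋀^Fin k]→L[ℝ] ℝ)
      (ContinuousAlternatingMap.curryLeftLI (𝕜 := ℝ) (E := E) (F := ℝ)
        (n := k)).toContinuousLinearMap hη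
    have h2 := h1.clm_comp hA.hasFDerivAt
    have h3 := (ContinuousAlternatingMap.alternatizeUncurryFinCLM ℝ E ℝ
      (n := k)).hasFDerivAt.comp x h2
    refine ⟨_, h3, fun u => ?_⟩
    simp only [ContinuousLinearMap.comp_apply, _root_.add_apply, map_add]
    rfl

/-- The local expression of the derivation `𝓛_A + i_B`, at the point `x`. -/
def localDer (A : E → E →L[ℝ] E) (B : E → E →L[ℝ] E →L[ℝ] E) {k : ℕ}
    (η : E → E [⋀^Fin k]→L[ℝ] ℝ) (x : E) : E [⋀^Fin (k + 1)]→L[ℝ] ℝ :=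
  insertEnd (A x) (k + 1) (extDeriv η x) - extDeriv (fun y => insertEnd (A y) k (η y)) x
    + insertBilin (B x) k (η x)

/-- In `i_A d - d i_A` the terms inserting `A` into a derivative of `η` cancel. There remain the
derivatives of `η` along `A (v i)`, and the derivatives of `A` inserted into `η`. -/
theorem localDer_apply {A : E → E →L[ℝ] E} (B : E → E →L[ℝ] E →L[ℝ] E) {k : ℕ}
    {η : E → E [⋀^Fin k]→L[ℝ] ℝ} {x : E} (hA : DifferentiableAt ℝ A x)
    (hη : DifferentiableAt ℝ η x) (v : Fin (k + 1) → E) :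
    localDer A B η x v = ∑ i : Fin (k + 1), (-1 : ℤ) ^ (i : ℕ) •
      (fderiv ℝ η x (A x (v i)) (i.removeNth v) -
        insertEnd (fderiv ℝ A x (v i)) k (η x) (i.removeNth v)) + insertBilin (B x) k (η x) v := by
  obtain ⟨T, hT, hT'⟩ := hasFDerivAt_insertEnd hA hη
  simp only [localDer, extDeriv, hT.fderiv,
    ContinuousAlternatingMap.add_apply, ContinuousAlternatingMap.sub_apply,
    insertEnd_alternatizeUncurryFin, ContinuousAlternatingMap.alternatizeUncurryFin_apply, hT']
  rw [← Finset.sum_sub_distrib]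
  congr 1
  refine Finset.sum_congr rfl fun i _ => ?_
  rw [← smul_sub]
  congr 1
  ring

theorem Filter.EventuallyEq.localDer_eq (A : E → E →L[ℝ] E) (B : E → E →L[ℝ] E →L[ℝ] E) {k : ℕ}
    {η θ : E → E [⋀^Fin k]→L[ℝ] ℝ} {x : E} (h : η =ᶠ[nhds x] θ) :
    localDer A B η x = localDer A B θ x := by
  have h' : (fun y => insertEnd (A y) k (η y)) =ᶠ[nhds x] fun y => insertEnd (A y) k (θ y) :=
    h.mono fun y hy => by simp only [hy]
  simp only [localDer, h.extDeriv_eq, h'.extDeriv_eq, h.eq_of_nhds]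

/-- Varying `P` in the direction `R` replaces one factor `P` by `R`; since `R = P Q R`, this is an
insertion into the pulled-back form. -/
theorem fderivCompContinuousLinearMap_eq_insertEnd {k : ℕ} (η : E [⋀^Fin k]→L[ℝ] ℝ)
    (P Q R : E →L[ℝ] E) (hPQ : P ∘L Q = .id ℝ E) :
    η.fderivCompContinuousLinearMap P R =
      insertEnd (Q ∘L R) k (η.compContinuousLinearMap P) := by
  have h : ∀ u, P (Q u) = u := fun u => by simpa using congrArg (fun f => f u) hPQ
  cases k with
  | zero => simp [ContinuousAlternatingMap.fderivCompContinuousLinearMap_of_isEmpty, insertEnd]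
  | succ k =>
    ext v
    rw [ContinuousAlternatingMap.fderivCompContinuousLinearMap_eq_alternatizeUncurryFin]
    simp only [ContinuousLinearMap.comp_apply,
      ContinuousAlternatingMap.alternatizeUncurryFinCLM_apply, insertEnd]
    congr 2
    ext u w
    simp only [ContinuousLinearMap.postcomp_apply, ContinuousLinearMap.comp_apply,
      ContinuousAlternatingMap.compContinuousLinearMapCLM_apply,
      ContinuousAlternatingMap.compContinuousLinearMap_apply,
      ContinuousAlternatingMap.curryLeft_apply_apply]
    congr 1
    ext l
    refine Fin.cases ?_ (fun l => ?_) l <;> simp [h]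

/-- The bilinear map `(u, w) ↦ A⁻¹ (∂_{A u} A) w - (∂_u A) w`, whose skew part measures the
torsion of `A`. -/
def skewSource (A : E → E →L[ℝ] E) (x : E) : E →L[ℝ] E →L[ℝ] E :=
  ContinuousLinearMap.compL ℝ E E E (A x).inverse ∘L (fderiv ℝ A x ∘L A x) - fderiv ℝ A x

theorem skewSource_apply (A : E → E →L[ℝ] E) (x u w : E) :
    skewSource A x u w = (A x).inverse (fderiv ℝ A x (A x u) w) - fderiv ℝ A x u w := rfl

/-- The derivation `𝓛_A + i_B` is conjugate to the exterior derivative, up to an insertion. -/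
theorem localDer_pullback {A : E → E →L[ℝ] E} (B : E → E →L[ℝ] E →L[ℝ] E) {k : ℕ}
    {η : E → E [⋀^Fin k]→L[ℝ] ℝ} {x : E} (hA : DifferentiableAt ℝ A x)
    (hη : DifferentiableAt ℝ η x) (hi : (A x).IsInvertible) :
    localDer A B (fun y => (η y).compContinuousLinearMap (A y)) x =
      (extDeriv η x).compContinuousLinearMap (A x) +
        insertBilin (B x + (skewSource A x - (skewSource A x).flip)) k
          ((η x).compContinuousLinearMap (A x)) := by
  -- The product rule along `A (v i)` gives the pullback of a derivative of `η`, plus the insertion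
  -- of `A⁻¹ (∂_{A (v i)} A)`. Together with the `-(∂_{v i} A)` of `localDer_apply` the latter is
  -- the insertion of `skewSource A x (v i)`, which alternates to an `insertBilin`.
  have hinv : A x ∘L (A x).inverse = .id ℝ E := hi.self_comp_inverse
  ext v
  rw [localDer_apply B hA (hη.continuousAlternatingMapCompContinuousLinearMap hA),
    insertBilin_add_left, ContinuousAlternatingMap.add_apply,
    ContinuousAlternatingMap.add_apply, ← sum_insertEnd_eq_insertBilin,
    fderiv_continuousAlternatingMapCompContinuousLinearMap hη hA,
    ContinuousAlternatingMap.compContinuousLinearMap_apply, extDeriv,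
    ContinuousAlternatingMap.alternatizeUncurryFin_apply, add_comm (insertBilin _ _ _ _),
    ← add_assoc, ← Finset.sum_add_distrib]
  congr 1
  refine Finset.sum_congr rfl fun i _ => ?_
  rw [← smul_add]
  congr 1
  simp only [_root_.add_apply, ContinuousLinearMap.comp_apply, ContinuousAlternatingMap.add_apply]
  rw [fderivCompContinuousLinearMap_eq_insertEnd _ _ _ _ hinv, add_sub_assoc,
    ← ContinuousAlternatingMap.sub_apply, ← insertEnd_sub_left]
  rfl

/-- The Nijenhuis torsion of `A` at `x`, evaluated on constant vector fields. -/
def localTorsion (A : E → E →L[ℝ] E) (x u w : E) : E :=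
  fderiv ℝ A x (A x u) w - fderiv ℝ A x (A x w) u - A x (fderiv ℝ A x u w)
    + A x (fderiv ℝ A x w u)

/-- Identifies the error term of `localDer_pullback` as `A⁻¹` of the torsion; applying `A` clears
the inverse. -/
theorem apply_skewSource_sub_flip {A : E → E →L[ℝ] E} {x : E} (hi : (A x).IsInvertible)
    (u w : E) :
    A x ((skewSource A x - (skewSource A x).flip) u w) = localTorsion A x u w := by
  simp only [_root_.sub_apply, ContinuousLinearMap.flip_apply, skewSource_apply, map_sub,
    hi.self_apply_inverse, localTorsion]
  abel

theorem add_skewSource_eq_zero {A : E → E →L[ℝ] E} {B : E →L[ℝ] E →L[ℝ] E} {y : E}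
    (hi : (A y).IsInvertible) (h : ∀ u w, A y (B u w) = -localTorsion A y u w) :
    B + (skewSource A y - (skewSource A y).flip) = 0 := by
  ext u w
  refine hi.injective ?_
  rw [_root_.add_apply, _root_.add_apply, map_add, h, apply_skewSource_sub_flip hi]
  simp

/-- Tensoriality of the torsion: all derivatives of `X` and `Y` cancel, leaving only derivatives of
`A`. -/
theorem lieBracket_torsion {A : E → E →L[ℝ] E} {X Y : E → E} {x : E}
    (hA : DifferentiableAt ℝ A x) (hX : DifferentiableAt ℝ X x) (hY : DifferentiableAt ℝ Y x) :
    VectorField.lieBracket ℝ (fun y => A y (X y)) (fun y => A y (Y y)) x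
      - A x (VectorField.lieBracket ℝ (fun y => A y (X y)) Y x)
      - A x (VectorField.lieBracket ℝ X (fun y => A y (Y y)) x)
      + A x (A x (VectorField.lieBracket ℝ X Y x)) = localTorsion A x (X x) (Y x) := by
  simp only [VectorField.lieBracket, fderiv_clm_apply hA hX, fderiv_clm_apply hA hY,
    _root_.add_apply, ContinuousLinearMap.comp_apply, ContinuousLinearMap.flip_apply, map_sub,
    map_add, localTorsion]
  abel

/-- Induction on the degree: contracting the pullback with a constant `u` gives the pullback of `η`
contracted with `P u`, of lower degree. A form of degree `k + 1` is recovered from its contractions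
by alternating and dividing by `k + 1`. Finite dimension allows smoothness of the operator-valued
map to be tested on each `u`. -/
theorem contDiffOn_compContinuousLinearMap [FiniteDimensional ℝ E] {P : E → E →L[ℝ] E} {s : Set E}
    (hP : ContDiffOn ℝ ∞ P s) : ∀ {k : ℕ} {η : E → E [⋀^Fin k]→L[ℝ] ℝ}, ContDiffOn ℝ ∞ η s →
      ContDiffOn ℝ ∞ (fun y => (η y).compContinuousLinearMap (P y)) s
  | 0, η, hη => hη.congr fun y _ => by
      ext v
      exact congrArg (η y) (Subsingleton.elim _ _)
  | k + 1, η, hη => by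
    have h1 : ContDiffOn ℝ ∞ (fun y => ((η y).compContinuousLinearMap (P y)).curryLeft) s := by
      rw [contDiffOn_clm_apply]
      intro u
      refine (contDiffOn_compContinuousLinearMap hP
        ((contDiff_curryLeft.comp_contDiffOn hη).clm_apply
          (hP.clm_apply (contDiffOn_const (c := u))))).congr fun y _ => ?_
      exact ContinuousAlternatingMap.curryLeft_compContinuousLinearMap _ _ _
    refine (((ContinuousAlternatingMap.alternatizeUncurryFinCLM ℝ E ℝ
      (n := k)).contDiff.comp_contDiffOn h1).const_smul ((k + 1 : ℝ)⁻¹)).congr fun y _ => ?_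
    have h2 := ContinuousAlternatingMap.alternatizeUncurryFin_curryLeft
      ((η y).compContinuousLinearMap (P y))
    rw [eq_inv_smul_iff₀ (by positivity)]
    refine Eq.trans ?_ h2.symm
    rw [← Nat.cast_smul_eq_nsmul ℝ]
    push_cast
    rfl

end Calculus

/-! ### Coordinate expressions of fields, forms, brackets, torsion and `D`. -/

section Charts

variable {E : Type*} [NormedAddCommGroup E] [NormedSpace ℝ E]

theorem mlieBracket_eq_lieBracket (V W : ∀ y : E, TangentSpace 𝓘(ℝ, E) y) (y : E) :
    VectorField.mlieBracket 𝓘(ℝ, E) V W y = VectorField.lieBracket ℝ (E := E) V W y := by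
  rw [← VectorField.mlieBracketWithin_univ, VectorField.mlieBracketWithin_eq_lieBracketWithin]
  exact congrFun (VectorField.lieBracketWithin_univ (E := E) (V := V) (W := W)) y

variable {M : Type*} [TopologicalSpace M] [ChartedSpace E M]

theorem target_mem_nhds {x₀ : M} {y : E} (hy : y ∈ (extChartAt 𝓘(ℝ, E) x₀).target) :
    (extChartAt 𝓘(ℝ, E) x₀).target ∈ nhds y :=
  (isOpen_extChartAt_target x₀).mem_nhds hy

theorem differentiableAt_inChart {k : ℕ} (α : DiffForm E M k) {x₀ : M} {y : E}
    (hy : y ∈ (extChartAt 𝓘(ℝ, E) x₀).target) : DifferentiableAt ℝ (inChart α.1 x₀) y :=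
  ((α.2 x₀).contDiffAt (target_mem_nhds hy)).differentiableAt (by simp)

/-- Allows any point to be replaced by `(extChartAt 𝓘(ℝ, E) x₀).symm y` by substitution, with no
transport between tangent spaces. -/
theorem exists_eq_extChartAt_symm (x : M) :
    ∃ (x₀ : M) (y : E), y ∈ (extChartAt 𝓘(ℝ, E) x₀).target ∧
      (extChartAt 𝓘(ℝ, E) x₀).symm y = x :=
  ⟨x, _, mem_extChartAt_target x, extChartAt_to_inv x⟩

variable [IsManifold 𝓘(ℝ, E) ∞ M]

theorem chartDInv_chartD_apply {x₀ : M} {y : E} (hy : y ∈ (extChartAt 𝓘(ℝ, E) x₀).target)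
    (v : E) : chartDInv x₀ y (chartD x₀ y v) = v := by
  simpa using congrArg (fun f => f v) (chartDInv_comp x₀ hy)

theorem chartD_chartDInv_apply {x₀ : M} {y : E} (hy : y ∈ (extChartAt 𝓘(ℝ, E) x₀).target)
    (v : E) : chartD x₀ y (chartDInv x₀ y v) = v := by
  simpa using congrArg (fun f => f v) (chartD_comp x₀ hy)

theorem chartD_injective {x₀ : M} {y : E} (hy : y ∈ (extChartAt 𝓘(ℝ, E) x₀).target) :
    Function.Injective (chartD x₀ y) :=
  Function.LeftInverse.injective (chartDInv_chartD_apply hy)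

theorem apply_eq_inChart {k : ℕ} (α : DiffForm E M k) {x₀ : M} {y : E}
    (hy : y ∈ (extChartAt 𝓘(ℝ, E) x₀).target)
    (v : Fin k → TangentSpace 𝓘(ℝ, E) ((extChartAt 𝓘(ℝ, E) x₀).symm y)) :
    α.1 ((extChartAt 𝓘(ℝ, E) x₀).symm y) v =
      inChart α.1 x₀ y (fun i => chartD x₀ y (v i)) := by
  refine congrArg (α.1 ((extChartAt 𝓘(ℝ, E) x₀).symm y)) (funext fun i => ?_)
  exact (chartDInv_chartD_apply hy (v i)).symm

theorem eq_zero_of_inChart {k : ℕ} {α : DiffForm E M k}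
    (h : ∀ (x₀ : M), ∀ y ∈ (extChartAt 𝓘(ℝ, E) x₀).target, inChart α.1 x₀ y = 0) : α = 0 := by
  ext x v
  obtain ⟨x₀, y, hy, rfl⟩ := exists_eq_extChartAt_symm (E := E) x
  rw [apply_eq_inChart α hy, h x₀ y hy]
  rfl

/-- The expression of a vector field in the chart at `x₀`. -/
def fieldInChart (X : VField E M) (x₀ : M) (y : E) : E :=
  chartD x₀ y (X ((extChartAt 𝓘(ℝ, E) x₀).symm y))

theorem differentiableAt_fieldInChart (X : VField E M) {x₀ : M} {y : E}
    (hy : y ∈ (extChartAt 𝓘(ℝ, E) x₀).target) : DifferentiableAt ℝ (fieldInChart X x₀) y :=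
  ((contDiffOn_chartD x₀ X.contMDiff.contMDiffOn).contDiffAt (target_mem_nhds hy)).differentiableAt
    (by simp)

/-- The pullback of a field uses the inverse of the derivative of the inverse chart, which on the
target is `chartD`. This gives access to the naturality of Lie brackets. -/
theorem mpullback_eventuallyEq_fieldInChart (X : VField E M) {x₀ : M} {y : E}
    (hy : y ∈ (extChartAt 𝓘(ℝ, E) x₀).target) :
    VectorField.mpullback 𝓘(ℝ, E) 𝓘(ℝ, E) (extChartAt 𝓘(ℝ, E) x₀).symm X
      =ᶠ[nhds y] fieldInChart X x₀ :=
  Filter.eventually_of_mem (target_mem_nhds hy) fun z hz =>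
    congrArg (fun f : E →L[ℝ] E => f (X ((extChartAt 𝓘(ℝ, E) x₀).symm z)))
      (ContinuousLinearMap.inverse_eq (f := chartDInv x₀ z) (g := chartD x₀ z)
        (chartDInv_comp x₀ hz) (chartD_comp x₀ hz))

theorem fieldInChart_applyEnd (K : EndTM E M) (X : VField E M) {x₀ : M} {y : E}
    (hy : y ∈ (extChartAt 𝓘(ℝ, E) x₀).target) :
    fieldInChart (applyEnd K X) x₀ y = endInChart K x₀ y (fieldInChart X x₀ y) := by
  refine congrArg (fun v : E => chartD x₀ y
    ((show E →L[ℝ] E from K ((extChartAt 𝓘(ℝ, E) x₀).symm y)) v)) ?_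
  exact (chartDInv_chartD_apply hy _).symm

theorem inChart_interior (X : VField E M) {k : ℕ} (α : DiffForm E M (k + 1)) {x₀ : M} {y : E}
    (hy : y ∈ (extChartAt 𝓘(ℝ, E) x₀).target) :
    inChart (interior X α).1 x₀ y = (inChart α.1 x₀ y).curryLeft (fieldInChart X x₀ y) :=
  curryLeft_comp (E := E) _ (chartDInv x₀ y) (chartD x₀ y) (chartDInv_comp x₀ hy) _

theorem inChart_ofFun (f : C^∞⟮𝓘(ℝ, E), M; ℝ⟯) (x₀ : M) :
    inChart (ofFun f).1 x₀ = fun y => ContinuousAlternatingMap.constOfIsEmpty ℝ E (Fin 0)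
      (f ((extChartAt 𝓘(ℝ, E) x₀).symm y)) := rfl

theorem fderiv_comp_extChartAt_symm (f : C^∞⟮𝓘(ℝ, E), M; ℝ⟯) {x₀ : M} {y : E}
    (hy : y ∈ (extChartAt 𝓘(ℝ, E) x₀).target) (u : E) :
    fderiv ℝ (fun z => f ((extChartAt 𝓘(ℝ, E) x₀).symm z)) y u =
      mfderiv 𝓘(ℝ, E) 𝓘(ℝ, ℝ) f ((extChartAt 𝓘(ℝ, E) x₀).symm y) (chartDInv x₀ y u) := by
  have h := mfderiv_comp (I := 𝓘(ℝ, E)) (I' := 𝓘(ℝ, E)) (I'' := 𝓘(ℝ, ℝ)) (g := f) y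
    (f.contMDiff.contMDiffAt.mdifferentiableAt (by simp))
    (((contMDiffOn_extChartAt_symm (I := 𝓘(ℝ, E)) (n := ∞) x₀).contMDiffAt
      (target_mem_nhds hy)).mdifferentiableAt (by simp))
  rw [mfderiv_eq_fderiv] at h
  exact congrArg (fun T : E →L[ℝ] ℝ => T u) h

theorem dirDeriv_eq_fderiv (X : VField E M) (f : C^∞⟮𝓘(ℝ, E), M; ℝ⟯) {x₀ : M} {y : E}
    (hy : y ∈ (extChartAt 𝓘(ℝ, E) x₀).target) :
    dirDeriv X f ((extChartAt 𝓘(ℝ, E) x₀).symm y) =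
      fderiv ℝ (fun z => f ((extChartAt 𝓘(ℝ, E) x₀).symm z)) y (fieldInChart X x₀ y) := by
  rw [fderiv_comp_extChartAt_symm f hy]
  exact congrArg (fun v : E => mfderiv 𝓘(ℝ, E) 𝓘(ℝ, ℝ) f ((extChartAt 𝓘(ℝ, E) x₀).symm y) v)
    (chartDInv_chartD_apply hy _).symm

theorem extDeriv_inChart_ofFun_apply (f : C^∞⟮𝓘(ℝ, E), M; ℝ⟯) (x₀ : M) (y : E)
    (v : Fin 1 → E) : extDeriv (inChart (ofFun f).1 x₀) y v =
      fderiv ℝ (fun z => f ((extChartAt 𝓘(ℝ, E) x₀).symm z)) y (v 0) := by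
  rw [inChart_ofFun, extDeriv_constOfIsEmpty]
  rfl

theorem bilinInChart_self (L : VectorTwoForm E M) (x₀ : M) (y v : E) :
    bilinInChart L x₀ y v v = 0 :=
  (congrArg (chartD x₀ y) (L.map_self _ (chartDInv x₀ y v))).trans (map_zero _)

theorem bilinInChart_fieldInChart (L : VectorTwoForm E M) (X Y : VField E M) {x₀ : M} {y : E}
    (hy : y ∈ (extChartAt 𝓘(ℝ, E) x₀).target) :
    bilinInChart L x₀ y (fieldInChart X x₀ y) (fieldInChart Y x₀ y) =
      chartD x₀ y (L.toSection ((extChartAt 𝓘(ℝ, E) x₀).symm y)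
        (X ((extChartAt 𝓘(ℝ, E) x₀).symm y)) (Y ((extChartAt 𝓘(ℝ, E) x₀).symm y))) := by
  have h (Z : VField E M) := chartDInv_chartD_apply hy (Z ((extChartAt 𝓘(ℝ, E) x₀).symm y))
  exact congrArg₂ (fun u w : E => chartD x₀ y ((show E →L[ℝ] E →L[ℝ] E from
    L.toSection ((extChartAt 𝓘(ℝ, E) x₀).symm y)) u w)) (h X) (h Y)

theorem isInvertible_endInChart {K : EndTM E M} (hK : ∀ x : M, (K x).IsInvertible) {x₀ : M} {y : E}
    (hy : y ∈ (extChartAt 𝓘(ℝ, E) x₀).target) : (endInChart K x₀ y).IsInvertible := by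
  have h1 : (chartD x₀ y).IsInvertible := .of_inverse (chartD_comp x₀ hy) (chartDInv_comp x₀ hy)
  have h2 : (chartDInv x₀ y).IsInvertible := .of_inverse (chartDInv_comp x₀ hy) (chartD_comp x₀ hy)
  have h3 : (show E →L[ℝ] E from K ((extChartAt 𝓘(ℝ, E) x₀).symm y)).IsInvertible := hK _
  exact h1.comp (h3.comp h2)

variable [FiniteDimensional ℝ E]

/-- Naturality of the bracket under pullback by the inverse chart; equality near `y` suffices
because the bracket depends only on germs. -/
theorem fieldInChart_lieBracket (X Y : VField E M) {x₀ : M} {y : E}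
    (hy : y ∈ (extChartAt 𝓘(ℝ, E) x₀).target) :
    fieldInChart (lieBracket X Y) x₀ y =
      VectorField.lieBracket ℝ (fieldInChart X x₀) (fieldInChart Y x₀) y := by
  have := isManifold_two E M
  have : CompleteSpace E := FiniteDimensional.complete ℝ E
  have h := VectorField.mpullback_mlieBracket (n := ∞) (mdifferentiableAt_field X _)
    (mdifferentiableAt_field Y _)
    ((contMDiffOn_extChartAt_symm (I := 𝓘(ℝ, E)) (n := ∞) x₀).contMDiffAt (target_mem_nhds hy))
    (by simpa using (ENat.LEInfty.out : (2 : ℕ∞ω) ≤ ∞))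
  have h' := h.trans ((mpullback_eventuallyEq_fieldInChart X hy).mlieBracket_vectorField_eq
    (mpullback_eventuallyEq_fieldInChart Y hy))
  exact (mpullback_eventuallyEq_fieldInChart (lieBracket X Y) hy).eq_of_nhds.symm.trans
    (h'.trans (mlieBracket_eq_lieBracket _ _ y))

theorem differentiableAt_endInChart (K : EndTM E M) {x₀ : M} {y : E}
    (hy : y ∈ (extChartAt 𝓘(ℝ, E) x₀).target) : DifferentiableAt ℝ (endInChart K x₀) y :=
  ((contDiffOn_endInChart K x₀).contDiffAt (target_mem_nhds hy)).differentiableAt (by simp)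

theorem fieldInChart_torsion (K : EndTM E M) (X Y : VField E M) {x₀ : M} {y : E}
    (hy : y ∈ (extChartAt 𝓘(ℝ, E) x₀).target) :
    fieldInChart (torsion K X Y) x₀ y =
      localTorsion (endInChart K x₀) y (fieldInChart X x₀ y) (fieldInChart Y x₀ y) := by
  have e (Z : VField E M) : fieldInChart (applyEnd K Z) x₀ =ᶠ[nhds y]
      fun z => endInChart K x₀ z (fieldInChart Z x₀ z) :=
    Filter.eventually_of_mem (target_mem_nhds hy) fun z hz => fieldInChart_applyEnd K Z hz
  rw [← lieBracket_torsion (differentiableAt_endInChart K hy) (differentiableAt_fieldInChart X hy)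
    (differentiableAt_fieldInChart Y hy)]
  have h : fieldInChart (torsion K X Y) x₀ y =
      fieldInChart (lieBracket (applyEnd K X) (applyEnd K Y)) x₀ y
      - fieldInChart (applyEnd K (lieBracket (applyEnd K X) Y)) x₀ y
      - fieldInChart (applyEnd K (lieBracket X (applyEnd K Y))) x₀ y
      + fieldInChart (applyEnd K (applyEnd K (lieBracket X Y))) x₀ y := by
    refine ((chartD x₀ y).map_add _ _).trans (congrArg (· + _) ?_)
    exact ((chartD x₀ y).map_sub _ _).trans (congrArg (· - _) ((chartD x₀ y).map_sub _ _))
  rw [h]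
  simp only [fieldInChart_applyEnd K _ hy, fieldInChart_lieBracket _ _ hy]
  rw [(e X).lieBracket_vectorField_eq (e Y), (e X).lieBracket_vectorField_eq .rfl,
    Filter.EventuallyEq.rfl.lieBracket_vectorField_eq (e Y)]

theorem inChart_iotaEnd (K : EndTM E M) {k : ℕ} (α : DiffForm E M k) {x₀ : M} {y : E}
    (hy : y ∈ (extChartAt 𝓘(ℝ, E) x₀).target) :
    inChart (iotaEnd K α).1 x₀ y = insertEnd (endInChart K x₀ y) k (inChart α.1 x₀ y) :=
  insertEnd_comp (E := E) _ (chartDInv x₀ y) (chartD x₀ y) (chartDInv_comp x₀ hy) k _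

theorem inChart_iotaTwo (L : VectorTwoForm E M) {k : ℕ} (α : DiffForm E M k) {x₀ : M} {y : E}
    (hy : y ∈ (extChartAt 𝓘(ℝ, E) x₀).target) :
    inChart (iotaTwo L α).1 x₀ y = insertBilin (bilinInChart L x₀ y) k (inChart α.1 x₀ y) := by
  refine insertBilin_comp (E := E) _ (chartDInv x₀ y) _ (fun u w => ?_) k _
  exact congrArg (fun f : E →L[ℝ] E => f _) (chartDInv_comp x₀ hy)

/-- In a chart, the derivation `D = 𝓛_K + i_L` is given by its local expression. -/
theorem inChart_fnDer (K : EndTM E M) (L : VectorTwoForm E M) {k : ℕ} (α : DiffForm E M k)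
    {x₀ : M} {y : E} (hy : y ∈ (extChartAt 𝓘(ℝ, E) x₀).target) :
    inChart (fnDer K L α).1 x₀ y =
      localDer (endInChart K x₀) (bilinInChart L x₀) (inChart α.1 x₀) y := by
  -- Equality on a neighbourhood is needed here, since this form gets differentiated.
  have e : inChart (iotaEnd K α).1 x₀ =ᶠ[nhds y]
      fun z => insertEnd (endInChart K x₀ z) k (inChart α.1 x₀ z) :=
    Filter.eventually_of_mem (target_mem_nhds hy) fun z hz => inChart_iotaEnd K α hz
  have h : inChart (fnDer K L α).1 x₀ y = inChart (iotaEnd K (extD α)).1 x₀ y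
      - inChart (extD (iotaEnd K α)).1 x₀ y + inChart (iotaTwo L α).1 x₀ y := rfl
  have hd : inChart (extD α).1 x₀ y = extDeriv (inChart α.1 x₀) y := inChart_rawExtD α x₀ hy
  have hd' : inChart (extD (iotaEnd K α)).1 x₀ y = extDeriv (inChart (iotaEnd K α).1 x₀) y :=
    inChart_rawExtD _ x₀ hy
  rw [h, inChart_iotaEnd K _ hy, hd, hd', inChart_iotaTwo L α hy, e.extDeriv_eq]
  rfl

theorem contDiffOn_inverse_endInChart {K : EndTM E M} (hK : ∀ x : M, (K x).IsInvertible) (x₀ : M) :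
    ContDiffOn ℝ ∞ (fun y => (endInChart K x₀ y).inverse) (extChartAt 𝓘(ℝ, E) x₀).target := by
  have : CompleteSpace E := FiniteDimensional.complete ℝ E
  intro y hy
  exact ((isInvertible_endInChart hK hy).contDiffAt_map_inverse).comp_contDiffWithinAt y
    (contDiffOn_endInChart K x₀ y hy)

end Charts

/-! ### Global fields and functions with prescribed behaviour at a point. -/

section Extension

variable {E : Type*} [NormedAddCommGroup E] [NormedSpace ℝ E] [FiniteDimensional ℝ E]
  {M : Type*} [TopologicalSpace M] [T2Space M] [ChartedSpace E M] [IsManifold 𝓘(ℝ, E) ∞ M]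

/-- Cut off the coordinate-constant field by a bump function; in a Hausdorff manifold its closed
support lies in the chart, so extension by zero is smooth. Identities between tensors can thus be
tested on global fields. -/
theorem exists_vField_apply_eq (x : M) (v : TangentSpace 𝓘(ℝ, E) x) :
    ∃ X : VField E M, X x = v := by
  obtain ⟨ψ⟩ : Nonempty (SmoothBumpFunction 𝓘(ℝ, E) x) := inferInstance
  let s : ∀ z : M, TangentSpace 𝓘(ℝ, E) z := fun z =>
    chartDInv (E := E) x (extChartAt 𝓘(ℝ, E) x z) (chartD (E := E) x (extChartAt 𝓘(ℝ, E) x x) v)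
  have hs := ContMDiffOn.smul_section_of_tsupport (s := s) (n := ∞) (ψ := ψ)
    ψ.contMDiff.contMDiffOn (chartAt E x).open_source ψ.tsupport_subset_chartAt_source
    (contMDiffOn_chartDInv x _)
  refine ⟨⟨_, hs⟩, ?_⟩
  have h : s x = v := chartDInv_chartD_apply (E := E) (mem_extChartAt_target x) v
  change ψ x • s x = v
  rw [ψ.eq_one, one_smul, h]

/-- Linear functionals of the chart, cut off by a bump function equal to one near `x`, are global
functions; their differentials separate vectors because functionals do so on `E` and the chart
derivative is injective. -/
theorem eq_zero_of_forall_mfderiv_eq_zero {x : M} {v : TangentSpace 𝓘(ℝ, E) x}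
    (h : ∀ f : C^∞⟮𝓘(ℝ, E), M; ℝ⟯, mfderiv 𝓘(ℝ, E) 𝓘(ℝ, ℝ) f x v = 0) : v = 0 := by
  have : IsManifold 𝓘(ℝ, E) 1 M := .of_le (n := ∞) (by simp)
  obtain ⟨ψ⟩ : Nonempty (SmoothBumpFunction 𝓘(ℝ, E) x) := inferInstance
  have hl (l : E →L[ℝ] ℝ) : l (chartDAt (E := E) x x v) = 0 := by
    have hg : ContMDiffOn 𝓘(ℝ, E) 𝓘(ℝ, ℝ) ∞ (fun z => l (extChartAt 𝓘(ℝ, E) x z))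
        (chartAt E x).source :=
      l.contMDiff.comp_contMDiffOn (contMDiffOn_extChartAt (n := ∞))
    have h1 := h ⟨_, ψ.contMDiff_smul hg⟩
    have h2 : (fun z => ψ z • l (extChartAt 𝓘(ℝ, E) x z)) =ᶠ[nhds x]
        fun z => l (extChartAt 𝓘(ℝ, E) x z) :=
      ψ.eventuallyEq_one.mono fun z hz => by simp [hz]
    have h3 := mfderiv_comp (I := 𝓘(ℝ, E)) (I' := 𝓘(ℝ, E)) (I'' := 𝓘(ℝ, ℝ)) (g := l)
      (f := extChartAt 𝓘(ℝ, E) x) x l.differentiableAt.mdifferentiableAt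
      (mdifferentiableAt_extChartAt (mem_chart_source E x))
    rw [mfderiv_eq_fderiv, l.fderiv] at h3
    have h4 := h2.mfderiv_eq (I := 𝓘(ℝ, E)) (I' := 𝓘(ℝ, ℝ))
    exact (congrArg (fun T : E →L[ℝ] ℝ => T v) (h4.trans h3)).symm.trans h1
  have h0 : chartDAt (E := E) x x v = 0 := by
    by_contra hne
    obtain ⟨l, hl'⟩ := SeparatingDual.exists_ne_zero (R := ℝ) hne
    exact hl' (hl l)
  have h5 := mfderivWithin_extChartAt_symm_comp_mfderiv_extChartAt' (I := 𝓘(ℝ, E)) (x := x)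
    (mem_extChartAt_source x)
  have h6 := congrArg (fun T : E →L[ℝ] E => T v) h5
  refine h6.symm.trans ?_
  exact (congrArg (mfderivWithin 𝓘(ℝ, E) 𝓘(ℝ, E) (extChartAt 𝓘(ℝ, E) x).symm
    (Set.range 𝓘(ℝ, E)) (extChartAt 𝓘(ℝ, E) x x)) h0).trans (map_zero _)

end Extension

/-! ### The criterion for `D² = 0`. -/

section SquareZero

variable {E : Type*} [NormedAddCommGroup E] [NormedSpace ℝ E]
  {M : Type*} [TopologicalSpace M] [ChartedSpace E M] [IsManifold 𝓘(ℝ, E) ∞ M]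
  [FiniteDimensional ℝ E]

/-- The equation `L (X, Y) = - K⁻¹ T_K (X, Y)` at a point, expressed in a chart. -/
theorem eq_neg_inverse_torsion_iff {K : EndTM E M} (hK : ∀ x : M, (K x).IsInvertible)
    (L : VectorTwoForm E M) (X Y : VField E M) {x₀ : M} {y : E}
    (hy : y ∈ (extChartAt 𝓘(ℝ, E) x₀).target) :
    (L.toSection ((extChartAt 𝓘(ℝ, E) x₀).symm y) (X ((extChartAt 𝓘(ℝ, E) x₀).symm y))
        (Y ((extChartAt 𝓘(ℝ, E) x₀).symm y)) =
      -(K ((extChartAt 𝓘(ℝ, E) x₀).symm y)).inverse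
        (torsion K X Y ((extChartAt 𝓘(ℝ, E) x₀).symm y))) ↔
    endInChart K x₀ y (bilinInChart L x₀ y (fieldInChart X x₀ y) (fieldInChart Y x₀ y)) =
      -localTorsion (endInChart K x₀) y (fieldInChart X x₀ y) (fieldInChart Y x₀ y) := by
  rw [← fieldInChart_torsion K X Y hy, bilinInChart_fieldInChart L X Y hy]
  -- Naming these with values in the model space `E` removes the dependent tangent-space types from
  -- the algebra.
  let k : E →L[ℝ] E := K ((extChartAt 𝓘(ℝ, E) x₀).symm y)
  let l : E := L.toSection ((extChartAt 𝓘(ℝ, E) x₀).symm y)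
    (X ((extChartAt 𝓘(ℝ, E) x₀).symm y)) (Y ((extChartAt 𝓘(ℝ, E) x₀).symm y))
  let t : E := torsion K X Y ((extChartAt 𝓘(ℝ, E) x₀).symm y)
  have hk : k.IsInvertible := hK _
  change l = -k.inverse t ↔ chartD x₀ y (k (chartDInv x₀ y (chartD x₀ y l))) = -chartD x₀ y t
  rw [chartDInv_chartD_apply hy, ← map_neg (chartD x₀ y), (chartD_injective hy).eq_iff]
  constructor
  · intro h
    rw [h, map_neg, hk.self_apply_inverse]
  · intro h
    rw [← map_neg, ← h, hk.inverse_apply_self]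

theorem fnDer_fnDer_eq_zero {K : EndTM E M} (hK : ∀ x : M, (K x).IsInvertible)
    {L : VectorTwoForm E M}
    (h : ∀ (x₀ : M), ∀ y ∈ (extChartAt 𝓘(ℝ, E) x₀).target, ∀ u w,
      endInChart K x₀ y (bilinInChart L x₀ y u w) = -localTorsion (endInChart K x₀) y u w)
    {k : ℕ} (α : DiffForm E M k) : fnDer K L (fnDer K L α) = 0 := by
  refine eq_zero_of_inChart fun x₀ y hy => ?_
  set A := endInChart K x₀
  set B := bilinInChart L x₀
  have hpull {m : ℕ} {η : E → E [⋀^Fin m]→L[ℝ] ℝ} {z : E}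
      (hz : z ∈ (extChartAt 𝓘(ℝ, E) x₀).target) (hη : DifferentiableAt ℝ η z) :
      localDer A B (fun y => (η y).compContinuousLinearMap (A y)) z =
        (extDeriv η z).compContinuousLinearMap (A z) := by
    rw [localDer_pullback B (differentiableAt_endInChart K hz) hη (isInvertible_endInChart hK hz),
      add_skewSource_eq_zero (isInvertible_endInChart hK hz) (h x₀ z hz), insertBilin_zero_left,
      add_zero]
  -- With `η = (A⁻¹)^* α` one has `α = A^* η`, hence `D α = A^* (dη)` and `D² α = A^* (d dη) = 0`.
  let η : E → E [⋀^Fin k]→L[ℝ] ℝ := fun z => (inChart α.1 x₀ z).compContinuousLinearMap (A z).inverse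
  have hη : ContDiffOn ℝ ∞ η (extChartAt 𝓘(ℝ, E) x₀).target :=
    contDiffOn_compContinuousLinearMap (contDiffOn_inverse_endInChart hK x₀) (α.2 x₀)
  have hη' {z : E} (hz : z ∈ (extChartAt 𝓘(ℝ, E) x₀).target) : DifferentiableAt ℝ η z :=
    (hη.contDiffAt (target_mem_nhds hz)).differentiableAt (by simp)
  have e1 : Set.EqOn (inChart α.1 x₀) (fun z => (η z).compContinuousLinearMap (A z))
      (extChartAt 𝓘(ℝ, E) x₀).target := fun z hz => by
    ext v
    simp [η, Function.comp_def, (isInvertible_endInChart hK hz).inverse_apply_self, A]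
  have e2 : Set.EqOn (inChart (fnDer K L α).1 x₀)
      (fun z => (extDeriv η z).compContinuousLinearMap (A z))
      (extChartAt 𝓘(ℝ, E) x₀).target := fun z hz => by
    rw [inChart_fnDer K L α hz, Filter.EventuallyEq.localDer_eq A B
      (Filter.eventually_of_mem (target_mem_nhds hz) e1), hpull hz (hη' hz)]
  have hd : DifferentiableAt ℝ (extDeriv η) y :=
    hasFDerivAt_clm_comp (ContinuousAlternatingMap.alternatizeUncurryFinCLM ℝ E ℝ (n := k))
      (((hη.fderiv_of_isOpen (m := ∞) (isOpen_extChartAt_target x₀) (by simp)).contDiffAt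
        (target_mem_nhds hy)).differentiableAt (by simp)) |>.differentiableAt
  rw [inChart_fnDer K L _ hy, Filter.EventuallyEq.localDer_eq A B
    (Filter.eventually_of_mem (target_mem_nhds hy) e2), hpull hy hd,
    extDeriv_extDeriv_apply (hη.contDiffAt (target_mem_nhds hy))
      (by simpa using (ENat.LEInfty.out : (2 : ℕ∞ω) ≤ ∞))]
  rfl

/-- On functions, `D f = K^* (d f)`. -/
theorem inChart_fnDer_ofFun (K : EndTM E M) (L : VectorTwoForm E M) (f : C^∞⟮𝓘(ℝ, E), M; ℝ⟯)
    {x₀ : M} {y : E} (hy : y ∈ (extChartAt 𝓘(ℝ, E) x₀).target) :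
    inChart (fnDer K L (ofFun f)).1 x₀ y =
      (extDeriv (inChart (ofFun f).1 x₀) y).compContinuousLinearMap (endInChart K x₀ y) := by
  rw [inChart_fnDer K L _ hy]
  ext v
  rw [localDer_apply _ (differentiableAt_endInChart K hy) (differentiableAt_inChart _ hy),
    ContinuousAlternatingMap.compContinuousLinearMap_apply, extDeriv,
    ContinuousAlternatingMap.alternatizeUncurryFin_apply]
  simp [insertEnd, insertBilin]
  congr 1
  exact Subsingleton.elim _ _

/-- Since `D f = A^* (df)` and `d df = 0`, only the error term of `localDer_pullback` survives in
`D² f`; on `(u, w)` it is `df` at `A` of the inserted two-form, which is `A B + T`. -/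
theorem fderiv_eq_zero_of_fnDer_fnDer {K : EndTM E M} (hK : ∀ x : M, (K x).IsInvertible)
    {L : VectorTwoForm E M} {f : C^∞⟮𝓘(ℝ, E), M; ℝ⟯}
    (hD : fnDer K L (fnDer K L (ofFun f)) = 0) {x₀ : M} {y : E}
    (hy : y ∈ (extChartAt 𝓘(ℝ, E) x₀).target) (u w : E) :
    fderiv ℝ (fun z => f ((extChartAt 𝓘(ℝ, E) x₀).symm z)) y
      (endInChart K x₀ y (bilinInChart L x₀ y u w) + localTorsion (endInChart K x₀) y u w) = 0 := by
  set A := endInChart K x₀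
  set B := bilinInChart L x₀
  set η := inChart (ofFun f).1 x₀
  have hη : ContDiffOn ℝ ∞ η (extChartAt 𝓘(ℝ, E) x₀).target := (ofFun f).2 x₀
  have hi : (A y).IsInvertible := isInvertible_endInChart hK hy
  have e : Set.EqOn (inChart (fnDer K L (ofFun f)).1 x₀)
      (fun z => (extDeriv η z).compContinuousLinearMap (A z))
      (extChartAt 𝓘(ℝ, E) x₀).target := fun z hz => inChart_fnDer_ofFun K L f hz
  have hd : DifferentiableAt ℝ (extDeriv η) y :=
    hasFDerivAt_clm_comp (ContinuousAlternatingMap.alternatizeUncurryFinCLM ℝ E ℝ (n := 0))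
      (((hη.fderiv_of_isOpen (m := ∞) (isOpen_extChartAt_target x₀) (by simp)).contDiffAt
        (target_mem_nhds hy)).differentiableAt (by simp)) |>.differentiableAt
  have h0 : inChart (fnDer K L (fnDer K L (ofFun f))).1 x₀ y = 0 := by rw [hD]; rfl
  rw [inChart_fnDer K L _ hy, Filter.EventuallyEq.localDer_eq A B
    (Filter.eventually_of_mem (target_mem_nhds hy) e),
    localDer_pullback B (differentiableAt_endInChart K hy) hd hi,
    extDeriv_extDeriv_apply (hη.contDiffAt (target_mem_nhds hy))
      (by simpa using (ENat.LEInfty.out : (2 : ℕ∞ω) ≤ ∞))] at h0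
  have h1 := congrArg (fun θ => θ ![u, w]) h0
  have hS : ∀ v, (B y + (skewSource A y - (skewSource A y).flip)) v v = 0 := fun v => by
    simp [ContinuousLinearMap.flip_apply, B, bilinInChart_self]
  rw [← apply_skewSource_sub_flip hi, ← map_add]
  rw [ContinuousAlternatingMap.add_apply, insertBilin_one_apply _ hS,
    ContinuousAlternatingMap.compContinuousLinearMap_apply,
    ContinuousAlternatingMap.compContinuousLinearMap_apply, extDeriv_inChart_ofFun_apply] at h1
  simpa using h1

variable [T2Space M]

theorem forall_fnDer_fnDer_eq_zero_iff {K : EndTM E M} (hK : ∀ x : M, (K x).IsInvertible)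
    (L : VectorTwoForm E M) :
    (∀ (k : ℕ) (α : DiffForm E M k), fnDer K L (fnDer K L α) = 0) ↔
      ∀ (X Y : VField E M) (x : M),
        L.toSection x (X x) (Y x) = -(K x).inverse (torsion K X Y x) := by
  constructor
  · intro hD X Y x
    obtain ⟨x₀, y, hy, rfl⟩ := exists_eq_extChartAt_symm (E := E) x
    rw [eq_neg_inverse_torsion_iff hK L X Y hy, eq_neg_iff_add_eq_zero]
    -- The obstruction is carried back to a tangent vector of `M`, where global functions can detect
    -- it. Only `D² = 0` in degree `0` enters.
    have h : chartDInv x₀ y (endInChart K x₀ y (bilinInChart L x₀ y (fieldInChart X x₀ y)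
        (fieldInChart Y x₀ y)) + localTorsion (endInChart K x₀) y (fieldInChart X x₀ y)
        (fieldInChart Y x₀ y)) = 0 := by
      refine eq_zero_of_forall_mfderiv_eq_zero (x := (extChartAt 𝓘(ℝ, E) x₀).symm y) fun f => ?_
      exact (fderiv_comp_extChartAt_symm f hy _).symm.trans
        (fderiv_eq_zero_of_fnDer_fnDer hK (hD 0 (ofFun f)) hy _ _)
    rw [← chartD_chartDInv_apply hy (_ + _), h, map_zero]
  · intro h k α
    refine fnDer_fnDer_eq_zero hK (fun x₀ y hy u w => ?_) α
    obtain ⟨X, hX⟩ := exists_vField_apply_eq (E := E) ((extChartAt 𝓘(ℝ, E) x₀).symm y)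
      (chartDInv x₀ y u)
    obtain ⟨Y, hY⟩ := exists_vField_apply_eq (E := E) ((extChartAt 𝓘(ℝ, E) x₀).symm y)
      (chartDInv x₀ y w)
    have hX' : fieldInChart X x₀ y = u :=
      (congrArg (chartD x₀ y) hX).trans (chartD_chartDInv_apply hy u)
    have hY' : fieldInChart Y x₀ y = w :=
      (congrArg (chartD x₀ y) hY).trans (chartD_chartDInv_apply hy w)
    rw [← hX', ← hY']
    exact (eq_neg_inverse_torsion_iff hK L X Y hy).1 (h X Y _)

end SquareZero

/-! ### The bracket formula in coordinates. -/

section LocalBracket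

variable {E : Type*} [NormedAddCommGroup E] [NormedSpace ℝ E]

theorem fderiv_curryLeft_apply {η : E → E [⋀^Fin 1]→L[ℝ] ℝ} {Y : E → E} {x : E}
    (hη : DifferentiableAt ℝ η x) (hY : DifferentiableAt ℝ Y x) :
    DifferentiableAt ℝ (fun y => (η y).curryLeft (Y y)) x ∧
      ∀ (u : E) (v : Fin 0 → E), fderiv ℝ (fun y => (η y).curryLeft (Y y)) x u v =
        fderiv ℝ η x u ![Y x] + η x ![fderiv ℝ Y x u] := by
  have h1 := hasFDerivAt_clm_comp (G := E →L[ℝ] E [⋀^Fin 0]→L[ℝ] ℝ)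
      (ContinuousAlternatingMap.curryLeftLI (𝕜 := ℝ) (E := E) (F := ℝ)
        (n := 0)).toContinuousLinearMap hη
  have h2 := h1.clm_apply hY.hasFDerivAt
  refine ⟨h2.differentiableAt, fun u v => ?_⟩
  refine (congrArg (fun T : E →L[ℝ] E [⋀^Fin 0]→L[ℝ] ℝ => T u v) h2.fderiv).trans ?_
  obtain rfl : v = ![] := Subsingleton.elim _ _
  exact add_comm _ _

/-- The bracket determined by `𝓛_A + i_B`, when `A (B (X, Y))` is minus the torsion of `A`. -/
theorem apply_bracket_eq_localDer {A : E → E →L[ℝ] E} (B : E → E →L[ℝ] E →L[ℝ] E)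
    {η : E → E [⋀^Fin 1]→L[ℝ] ℝ} {X Y : E → E} {x b : E} (hA : DifferentiableAt ℝ A x)
    (hη : DifferentiableAt ℝ η x) (hX : DifferentiableAt ℝ X x) (hY : DifferentiableAt ℝ Y x)
    (hi : (A x).IsInvertible) (hB : ∀ v, B x v v = 0)
    (hT : A x (B x (X x) (Y x)) = -localTorsion A x (X x) (Y x))
    (hb : A x b = VectorField.lieBracket ℝ (fun y => A y (X y)) (fun y => A y (Y y)) x) :
    η x ![b] = localDer A B (fun y => (η y).curryLeft (Y y)) x ![X x]
      - localDer A B (fun y => (η y).curryLeft (X y)) x ![Y x] - localDer A B η x ![X x, Y x] := by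
  -- In the right side of the goal the derivatives of `η` cancel, leaving `η` at this vector.
  -- Applying `A` and using `hT` turns it into the coordinate bracket of `A X` and `A Y`.
  have hb' : b = fderiv ℝ Y x (A x (X x)) - fderiv ℝ X x (A x (Y x)) + fderiv ℝ A x (X x) (Y x)
      - fderiv ℝ A x (Y x) (X x) - B x (X x) (Y x) := by
    refine hi.injective ?_
    rw [hb]
    simp only [map_sub, map_add, hT, VectorField.lieBracket, fderiv_clm_apply hA hX,
      fderiv_clm_apply hA hY, _root_.add_apply, ContinuousLinearMap.comp_apply,
      ContinuousLinearMap.flip_apply, localTorsion]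
    abel
  -- The one-form as a linear functional, so that it can be expanded on the sum in `hb'`.
  let l : E →ₗ[ℝ] ℝ :=
    { toFun v := η x ![v]
      map_add' u w := congrArg (fun θ => θ ![]) ((η x).curryLeft.map_add u w)
      map_smul' c u := congrArg (fun θ => θ ![]) ((η x).curryLeft.map_smul c u) }
  have hl (v : E) : η x ![v] = l v := rfl
  obtain ⟨hdX, hX'⟩ := fderiv_curryLeft_apply hη hX
  obtain ⟨hdY, hY'⟩ := fderiv_curryLeft_apply hη hY
  have h1 (u w : E) : Fin.removeNth 1 ![u, w] = ![u] := by
    ext i; fin_cases i; rfl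
  have h2 (u w : E) : Function.update ![u] 0 w = ![w] := by
    ext i; fin_cases i; rfl
  rw [localDer_apply B hA hdY, localDer_apply B hA hdX, localDer_apply B hA hη,
    insertBilin_one_apply _ hB]
  simp only [Fin.sum_univ_one, hX', hY', insertEnd_apply', insertBilin, Finset.univ_eq_empty,
    Finset.sum_empty]
  simp [hl, hb', h1, h2]
  ring

end LocalBracket

/-! ### The transported algebroid, its relation to `D`, and uniqueness. -/

section Algebroid

variable {E : Type*} [NormedAddCommGroup E] [NormedSpace ℝ E]
  {M : Type*} [TopologicalSpace M] [ChartedSpace E M] [IsManifold 𝓘(ℝ, E) ∞ M]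

theorem applyEnd_mulField (K : EndTM E M) (f : C^∞⟮𝓘(ℝ, E), M; ℝ⟯) (X : VField E M) :
    applyEnd K (mulField f X) = mulField f (applyEnd K X) := by
  ext x
  exact (K x).map_smul (f x) (X x)

/-- Serves uniqueness: inserting `α = df` in the bracket formula yields the derivative of `f` along
the bracket. -/
theorem extD_ofFun_apply (f : C^∞⟮𝓘(ℝ, E), M; ℝ⟯) (x : M) (v : TangentSpace 𝓘(ℝ, E) x) :
    (extD (ofFun f)).1 x ![v] = mfderiv 𝓘(ℝ, E) 𝓘(ℝ, ℝ) f x v := by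
  obtain ⟨x₀, y, hy, rfl⟩ := exists_eq_extChartAt_symm (E := E) x
  have h : inChart (extD (ofFun f)).1 x₀ y = extDeriv (inChart (ofFun f).1 x₀) y :=
    inChart_rawExtD _ x₀ hy
  rw [apply_eq_inChart _ hy, h, extDeriv_inChart_ofFun_apply, fderiv_comp_extChartAt_symm f hy]
  exact congrArg (fun u : E => mfderiv 𝓘(ℝ, E) 𝓘(ℝ, ℝ) f ((extChartAt 𝓘(ℝ, E) x₀).symm y) u)
    (chartDInv_chartD_apply hy v)

variable [FiniteDimensional ℝ E]

/-- The inverse of an invertible endomorphism of `TM`. -/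
def inverseEnd (K : EndTM E M) (hK : ∀ x : M, (K x).IsInvertible) : EndTM E M :=
  ⟨fun x => (K x).inverse, fun x₀ => by
    have : CompleteSpace E := FiniteDimensional.complete ℝ E
    rw [contMDiffAt_hom_bundle]
    refine ⟨contMDiffAt_id, ?_⟩
    have h := ((contMDiffAt_hom_bundle _).1 (K.contMDiff x₀)).2
    have hx₀ := FiberBundle.mem_baseSet_trivializationAt' (F := E)
      (E := (TangentSpace 𝓘(ℝ, E) : M → Type _)) x₀
    have hi : (ContinuousLinearMap.inCoordinates E (TangentSpace 𝓘(ℝ, E) (M := M)) E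
        (TangentSpace 𝓘(ℝ, E) (M := M)) x₀ x₀ x₀ x₀ (K x₀)).IsInvertible := by
      rw [ContinuousLinearMap.inCoordinates_eq hx₀ hx₀]
      exact ContinuousLinearMap.isInvertible_equiv.comp
        ((hK x₀).comp ContinuousLinearMap.isInvertible_equiv)
    -- Operator inversion is smooth at invertible operators and commutes with conjugation by the
    -- trivialization.
    refine ((hi.contDiffAt_map_inverse (n := ∞)).contMDiffAt.comp x₀ h).congr_of_eventuallyEq ?_
    filter_upwards [(trivializationAt E (TangentSpace 𝓘(ℝ, E) : M → Type _)
      x₀).open_baseSet.mem_nhds hx₀] with x hx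
    simp only [Function.comp_apply]
    rw [ContinuousLinearMap.inCoordinates_eq hx hx, ContinuousLinearMap.inCoordinates_eq hx hx,
      ContinuousLinearMap.inverse_equiv_comp, ContinuousLinearMap.inverse_comp_equiv]
    rfl⟩

theorem applyEnd_inverseEnd {K : EndTM E M} (hK : ∀ x : M, (K x).IsInvertible) (X : VField E M) :
    applyEnd K (applyEnd (inverseEnd K hK) X) = X := by
  ext x
  exact (hK x).self_apply_inverse (X x)

/-- The action of an endomorphism of `TM` on vector fields, as a linear map. -/
def applyEndLinear (K : EndTM E M) : VField E M →ₗ[ℝ] VField E M where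
  toFun := applyEnd K
  map_add' X Y := by
    ext x
    exact (K x).map_add (X x) (Y x)
  map_smul' c X := by
    ext x
    exact (K x).map_smul c (X x)

/-- The Lie algebroid structure on `TM` with anchor `K` and bracket `K⁻¹ [K X, K Y]`. -/
def conjugateAlgebroid (K : EndTM E M) (hK : ∀ x : M, (K x).IsInvertible) :
    LieAlgebroidTM E M where
  anchor := K
  bracket := ((lieBracketBilin E M).compl₁₂ (applyEndLinear K) (applyEndLinear K)).compr₂
    (applyEndLinear (inverseEnd K hK))
  bracket_self X := by
    have h := congrArg (applyEndLinear (inverseEnd K hK))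
      ((trivialAlgebroid E M).bracket_self (applyEnd K X))
    rw [map_zero] at h
    exact h
  jacobi X Y Z := by
    have h := congrArg (applyEndLinear (inverseEnd K hK))
      ((trivialAlgebroid E M).jacobi (applyEnd K X) (applyEnd K Y) (applyEnd K Z))
    rw [map_add] at h
    -- Each inner `K K⁻¹` cancels, so this is `K⁻¹` applied to the Jacobi identity for `K X`, `K Y`,
    -- `K Z`.
    change applyEnd (inverseEnd K hK) (lieBracket (applyEnd K X) (applyEnd K
        (applyEnd (inverseEnd K hK) (lieBracket (applyEnd K Y) (applyEnd K Z))))) =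
      applyEnd (inverseEnd K hK) (lieBracket (applyEnd K
        (applyEnd (inverseEnd K hK) (lieBracket (applyEnd K X) (applyEnd K Y)))) (applyEnd K Z)) +
      applyEnd (inverseEnd K hK) (lieBracket (applyEnd K Y) (applyEnd K
        (applyEnd (inverseEnd K hK) (lieBracket (applyEnd K X) (applyEnd K Z)))))
    rw [applyEnd_inverseEnd, applyEnd_inverseEnd, applyEnd_inverseEnd]
    exact h
  leibniz X Y f x := by
    have h := congrArg (K x).inverse
      ((trivialAlgebroid E M).leibniz (applyEnd K X) (applyEnd K Y) f x)
    rw [map_add, map_smul, map_smul, ← applyEnd_mulField] at h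
    have h' : (K x).inverse (applyEnd K Y x) = Y x := (hK x).inverse_apply_self (Y x)
    rw [h'] at h
    exact h

theorem isDeterminedBy_conjugateAlgebroid {K : EndTM E M} (hK : ∀ x : M, (K x).IsInvertible)
    {L : VectorTwoForm E M}
    (hL : ∀ (X Y : VField E M) (x : M),
      L.toSection x (X x) (Y x) = -(K x).inverse (torsion K X Y x)) :
    (conjugateAlgebroid K hK).IsDeterminedBy (fnDer K L) where
  anchor_eq X f x := by
    obtain ⟨x₀, y, hy, rfl⟩ := exists_eq_extChartAt_symm (E := E) x
    rw [apply_eq_inChart _ hy, inChart_fnDer_ofFun K L f hy]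
    refine (dirDeriv_eq_fderiv (applyEnd K X) f hy).trans ?_
    rw [fieldInChart_applyEnd K X hy, ContinuousAlternatingMap.compContinuousLinearMap_apply,
      extDeriv_inChart_ofFun_apply]
    rfl
  bracket_eq X Y α x := by
    obtain ⟨x₀, y, hy, rfl⟩ := exists_eq_extChartAt_symm (E := E) x
    have eA (Z : VField E M) : fieldInChart (applyEnd K Z) x₀ =ᶠ[nhds y]
        fun z => endInChart K x₀ z (fieldInChart Z x₀ z) :=
      Filter.eventually_of_mem (target_mem_nhds hy) fun z hz => fieldInChart_applyEnd K Z hz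
    have eI (Z : VField E M) : inChart (interior Z α).1 x₀ =ᶠ[nhds y]
        fun z => (inChart α.1 x₀ z).curryLeft (fieldInChart Z x₀ z) :=
      Filter.eventually_of_mem (target_mem_nhds hy) fun z hz => inChart_interior Z α hz
    -- Applying `K` to the new bracket gives `[K X, K Y]`, the form needed by
    -- `apply_bracket_eq_localDer`.
    have hb : endInChart K x₀ y (fieldInChart ((conjugateAlgebroid K hK).bracket X Y) x₀ y) =
        VectorField.lieBracket ℝ (fun z => endInChart K x₀ z (fieldInChart X x₀ z))
          (fun z => endInChart K x₀ z (fieldInChart Y x₀ z)) y := by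
      rw [← (eA X).lieBracket_vectorField_eq (eA Y), ← fieldInChart_lieBracket _ _ hy,
        ← fieldInChart_applyEnd K _ hy]
      exact congrArg (fun Z => fieldInChart Z x₀ y) (applyEnd_inverseEnd hK _)
    have h := apply_bracket_eq_localDer (bilinInChart L x₀) (differentiableAt_endInChart K hy)
      (differentiableAt_inChart α hy) (differentiableAt_fieldInChart X hy)
      (differentiableAt_fieldInChart Y hy) (isInvertible_endInChart hK hy)
      (bilinInChart_self L x₀ y) ((eq_neg_inverse_torsion_iff hK L X Y hy).1 (hL X Y _)) hb
    rw [← Filter.EventuallyEq.localDer_eq _ _ (eI X), ← Filter.EventuallyEq.localDer_eq _ _ (eI Y),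
      ← inChart_fnDer K L _ hy, ← inChart_fnDer K L _ hy, ← inChart_fnDer K L _ hy] at h
    have e1 {W : Type _} (g : E → W) (u : E) : (fun i => g (![u] i)) = ![g u] := by
      ext i; fin_cases i; rfl
    have e2 {W : Type _} (g : E → W) (u w : E) : (fun i => g (![u, w] i)) = ![g u, g w] := by
      ext i; fin_cases i <;> rfl
    rw [apply_eq_inChart _ hy, apply_eq_inChart _ hy, apply_eq_inChart _ hy,
      apply_eq_inChart _ hy]
    refine (congrArg (inChart α.1 x₀ y) (e1 (chartD x₀ y) _)).trans (h.trans ?_)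
    exact congrArg₂ (· - ·) (congrArg₂ (· - ·)
      (congrArg (inChart (fnDer K L (interior Y α)).1 x₀ y) (e1 (chartD x₀ y) _).symm)
      (congrArg (inChart (fnDer K L (interior X α)).1 x₀ y) (e1 (chartD x₀ y) _).symm))
      (congrArg (inChart (fnDer K L α).1 x₀ y) (e2 (chartD x₀ y) _ _).symm)

/-- The anchor `K` is an isomorphism onto the trivial Lie algebroid. -/
def conjugateAlgebroidIso (K : EndTM E M) (hK : ∀ x : M, (K x).IsInvertible) :
    (conjugateAlgebroid K hK).Iso (trivialAlgebroid E M) where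
  toEnd := K
  isInvertible := hK
  anchor_comp _ _ := rfl
  map_bracket X Y := applyEnd_inverseEnd hK (lieBracket (applyEnd K X) (applyEnd K Y))

variable [T2Space M]

theorem eq_of_forall_mfderiv_eq {x : M} {v w : TangentSpace 𝓘(ℝ, E) x}
    (h : ∀ f : C^∞⟮𝓘(ℝ, E), M; ℝ⟯, mfderiv 𝓘(ℝ, E) 𝓘(ℝ, ℝ) f x v =
      mfderiv 𝓘(ℝ, E) 𝓘(ℝ, ℝ) f x w) : v = w :=
  sub_eq_zero.1 (eq_zero_of_forall_mfderiv_eq_zero fun f => by rw [map_sub, h f, sub_self])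

/-- A derivation determines at most one Lie algebroid structure on `TM`. -/
theorem LieAlgebroidTM.IsDeterminedBy.unique {𝓐 𝓑 : LieAlgebroidTM E M}
    {D : ∀ {k : ℕ}, DiffForm E M k → DiffForm E M (k + 1)} (hA : 𝓐.IsDeterminedBy D)
    (hB : 𝓑.IsDeterminedBy D) : 𝓐 = 𝓑 := by
  refine LieAlgebroidTM.ext ?_ ?_
  · ext x v
    obtain ⟨X, rfl⟩ := exists_vField_apply_eq (E := E) x v
    exact eq_of_forall_mfderiv_eq fun f => (hA.anchor_eq X f x).trans (hB.anchor_eq X f x).symm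
  · ext X Y x
    refine eq_of_forall_mfderiv_eq fun f => ?_
    -- The two brackets are compared through the exact one-forms `df`, which suffice to separate
    -- vectors.
    rw [← extD_ofFun_apply, ← extD_ofFun_apply]
    exact (hA.bracket_eq X Y _ x).trans (hB.bracket_eq X Y _ x).symm

end Algebroid

end TangentAlgebroid
end

theorem mainTheorem7 {E : Type*} [NormedAddCommGroup E] [NormedSpace ℝ E] [FiniteDimensional ℝ E]
    {M : Type*} [TopologicalSpace M] [T2Space M] [ChartedSpace E M] [IsManifold 𝓘(ℝ, E) ∞ M]
    (K : TangentAlgebroid.EndTM E M) (hK : ∀ x : M, (K x).IsInvertible)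
    (L : TangentAlgebroid.VectorTwoForm E M) :
    ((∀ (k : ℕ) (α : TangentAlgebroid.DiffForm E M k),
        TangentAlgebroid.fnDer K L (TangentAlgebroid.fnDer K L α) = 0) ↔
      ∀ (X Y : TangentAlgebroid.VField E M) (x : M),
        L.toSection x (X x) (Y x) = -(K x).inverse (TangentAlgebroid.torsion K X Y x)) ∧
    ((∀ (k : ℕ) (α : TangentAlgebroid.DiffForm E M k),
        TangentAlgebroid.fnDer K L (TangentAlgebroid.fnDer K L α) = 0) →
      ∃ 𝓐 : TangentAlgebroid.LieAlgebroidTM E M,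
        𝓐.IsDeterminedBy (TangentAlgebroid.fnDer K L) ∧
        (∀ 𝓑 : TangentAlgebroid.LieAlgebroidTM E M,
          𝓑.IsDeterminedBy (TangentAlgebroid.fnDer K L) → 𝓑 = 𝓐) ∧
        𝓐.anchor = K ∧
        (∀ (X Y : TangentAlgebroid.VField E M) (x : M),
          𝓐.bracket X Y x = (K x).inverse (TangentAlgebroid.lieBracket
            (TangentAlgebroid.applyEnd K X) (TangentAlgebroid.applyEnd K Y) x)) ∧
        Nonempty (𝓐.Iso (TangentAlgebroid.trivialAlgebroid E M))) := by
  have h := TangentAlgebroid.forall_fnDer_fnDer_eq_zero_iff hK L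
  refine ⟨h, fun hD => ?_⟩
  have hdet := TangentAlgebroid.isDeterminedBy_conjugateAlgebroid hK (h.1 hD)
  exact ⟨TangentAlgebroid.conjugateAlgebroid K hK, hdet, fun 𝓑 hB => hB.unique hdet, rfl,
    fun _ _ _ => rfl, ⟨TangentAlgebroid.conjugateAlgebroidIso K hK⟩⟩
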